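/- **Setting.** Let $\Sigma$ (constants) and $\Pi$ (parameters) be finite disjoint alphabets. Strings over $\Sigma\cup\Pi$ are p-strings. Two p-strings $w_1,w_2$ of equal length p-match if some bijection $f$ of $\Sigma\cup\Pi$ with $f(a)=a$ for all $a\in\Sigma$ satisfies $f(w_1[i])=w_2[i]$ for all $i$. The prev-encoding $\langle w\rangle$ of $w$ keeps constants and replaces a parameter at position $i$ by $0$ if it has not occurred before, and otherwise by the distance from $i$ to its last earlier occurrence. For a string $u$ over $\Sigma\cup\mathbb N$, its $k$-re-encoding ($k\in\mathbb Z$) replaces each number $u[i]\ge i-k+1$ by $0$; for nonempty $u$, $\mathsf{sl}(u)$ is the $1$-re-encoding of $u[2:]$. Let $T$ be a p-string that ends with a sentinel $\$\in\Sigma$ occurring nowhere else in $T$, and let $U$ be the set of prev-encodings of substrings of $T$. The node set $V$ of $\mathsf{PLST}(T)$ consists of the root $\varepsilon$, of the Type 1 nodes ($u\in U$ that are leaves or branching in the trie of $U$), and of the Type 2 nodes (the other nonempty $u\in U$ for which $\mathsf{sl}(u)$ is of Type 1). A pair $(u,v)\in V^2$ is an edge if $v$ is a proper extension of $u$ and no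 node lies strictly between; write $v=u\cdot\mathrm{str}(u,v)$ whenever $v$ extends $u$. A node $u\neq\varepsilon$ is good if $\mathsf{sl}(u)\in V$; all other nodes, including $\varepsilon$, are bad. For an edge $(u,v)$, the re-encoding sign $\mathsf{Re}(v)$ is $i-|u|$ if there is $i$ with $|u|<i\le|v|$ and $v[i]=i-1$, and $0$ otherwise. $\mathsf{PLST}(T)$ stores, for every node, its depth $|u|$, its suffix link $\mathsf{SL}(u)$ (a pointer to $\mathsf{sl}(u)$ if $u$ is good, null otherwise), its re-encoding sign and the list of its outgoing edges. An edge $(u,v)$ is labelled by the first symbol of $\mathrm{str}(u,v)$ if $u,v$ are both good or $|v|-|u|=1$, and otherwise by a triple $(i,j,k)$ such that $\mathrm{str}(u,v)$ is the interval $[i:j]$ of the $k$-re-encoding of a stored subsequence $T'$ of $\langle T\rangle$. For every edge $(u,v)$ with $u,v$ good and $|v|-|u|>1$ the fast link $\mathsf{FL}(u,v)=\mathsf{SL}^k(u)$ is stored as well, where $k\ge1$ is least such that, for the child $v_k$ of $\mathsf{SL}^k(u)$ whose edge begins with the first symbol of $\mathrm{str}(\mathsf{sl}^k(u),\mathsf{sl}^k(v))$,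 one has $|v_k|<|v|-k$, or $\mathsf{Re}(v_k)>0$, or $\mathsf{SL}^k(u)$ or $v_k$ is bad. **Algorithm.** $\textsc{P-Match}(p,u)$, with $p$ held in a rewritable array, returns $u$ if $p=\varepsilon$. Otherwise it looks for the child $v$ of $u$ whose edge begins with $p[1]$, and returns null if there is none. Let $l=\min\{|p|,|v|-|u|\}$. If $l\ge2$ and $u$ or $v$ is bad, it compares $p[1:l]$ with the label read from $T'$ and returns null if they differ. If $l\ge2$ and $u,v$ are good, then, in case $1\le\mathsf{Re}(v)\le|p|$, it checks that $p[\mathsf{Re}(v)]=|u|+\mathsf{Re}(v)-1$, returns null if not, and sets $p[\mathsf{Re}(v)]$ to $0$; then it calls $\textsc{P-Match}(p[1:l],\mathsf{FL}(u,v))$ and returns null if that call does. Finally it returns $\textsc{P-Match}(p[l+1:],v)$. The time is the number of unit-cost steps, each performing a bounded number of elementary array, table, pointer and arithmetic operations; searching a list of edges costs one step per entry and comparing a label costs one step per symbol. **Theorem.** There is a constant $C$, depending only on $\Sigma$ and $\Pi$, such that for every such text $T$, every $\mathsf{PLST}(T)$ with fast links and every p-string $P$ of length $m\ge0$, computing $p=\langle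 P\rangle$ and then running $\textsc{P-Match}(p,\varepsilon)$ halts after at most $C(m+1)$ steps, and it returns a node (not null) if and only if $T$ has a substring that p-matches $P$. This run follows at most $3m$ fast links. Moreover, for all nodes $u,v\in V$ such that $v$ extends $u$ (in particular, for every edge $(u,v)$), the call $\textsc{P-Match}(p,u)$ with $p=\mathrm{str}(u,v)$ returns $v$ and follows at most $2|p|$ fast links. -/

import Mathlib

namespace PLST

/-! ### Parameterized strings and prev-encoding

`S` is the alphabet of constant symbols and `Q` the alphabet of parameter symbols.  -/

/-- Symbols of p-strings. -/
abbrev PSym (S Q : Type*) := S ⊕ Q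

/-- Symbols of pv-strings: constants and natural numbers. -/
abbrev PvSym (S : Type*) := S ⊕ ℕ

/-- Parameterized match: some bijection of the symbols that fixes every constant maps `w₁`
to `w₂` letter by letter. -/
def PMatch {S Q : Type*} (w₁ w₂ : List (PSym S Q)) : Prop :=
  ∃ f : Equiv.Perm (PSym S Q), (∀ a : S, f (Sum.inl a) = Sum.inl a) ∧ w₁.map f = w₂

section Encoding

variable {S Q : Type*} [DecidableEq S] [DecidableEq Q]

/-- Distance from position `i` (counted from `0`) to the last earlier occurrence of the
parameter `x` in `w`, and `0` if there is none. -/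
def prevDist (w : List (PSym S Q)) (i : ℕ) (x : Q) : ℕ :=
  match ((List.range i).filter (fun j => w[j]? = some (Sum.inr x))).max? with
  | none => 0
  | some k => i - k

/-- Prev-encoding of a p-string. -/
def prevEnc (w : List (PSym S Q)) : List (PvSym S) :=
  w.mapIdx fun i c =>
    match c with
    | Sum.inl a => Sum.inl a
    | Sum.inr x => Sum.inr (prevDist w i x)

end Encoding

/-- What the `k`-re-encoding does to the symbol `a` at position `i` (counted from `1`). -/
def reSym {S : Type*} (k : ℤ) (i : ℕ) (a : PvSym S) : PvSym S :=
  match a with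
  | Sum.inl c => Sum.inl c
  | Sum.inr d => if (i : ℤ) - k + 1 ≤ (d : ℤ) then Sum.inr 0 else Sum.inr d

/-- The `k`-re-encoding of a pv-string. -/
def reencode {S : Type*} (k : ℤ) (u : List (PvSym S)) : List (PvSym S) :=
  u.mapIdx fun i a => reSym k (i + 1) a

/-- Implicit suffix link: delete the first symbol and re-encode. -/
def sl {S : Type*} (u : List (PvSym S)) : List (PvSym S) :=
  reencode 1 u.tail

/-! ### The nodes, edges, suffix links and fast links of `PLST(T)`, as strings -/

section Strings

variable {S Q : Type*} [DecidableEq S] [DecidableEq Q]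

/-- The pv-substrings of `T`, which are the nodes of the parameterized suffix trie. -/
def PrevSub (T : List (PSym S Q)) : Set (List (PvSym S)) :=
  {u | ∃ w, w <:+: T ∧ prevEnc w = u}

/-- Type 1 nodes: the leaves and the branching nodes of the parameterized suffix trie. -/
def TypeOne (T : List (PSym S Q)) : Set (List (PvSym S)) :=
  {u | u ∈ PrevSub T ∧
    ((∀ a, u ++ [a] ∉ PrevSub T) ∨
      ∃ a b, a ≠ b ∧ u ++ [a] ∈ PrevSub T ∧ u ++ [b] ∈ PrevSub T)}

/-- Type 2 nodes: the other nodes whose suffix link is a Type 1 node. -/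
def TypeTwo (T : List (PSym S Q)) : Set (List (PvSym S)) :=
  {u | u ∈ PrevSub T ∧ u ∉ TypeOne T ∧ u ≠ [] ∧ sl u ∈ TypeOne T}

/-- The nodes of `PLST(T)`. The root is of Type 1 except when `T` is the sentinel alone;
it is a node in that case too. -/
def nodes (T : List (PSym S Q)) : Set (List (PvSym S)) :=
  {[]} ∪ TypeOne T ∪ TypeTwo T

/-- `(u, v)` is an edge: `v` is a proper extension of `u`, and no node lies strictly
between them. -/
def IsEdge (T : List (PSym S Q)) (u v : List (PvSym S)) : Prop :=
  u ∈ nodes T ∧ v ∈ nodes T ∧ u <+: v ∧ u ≠ v ∧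
    ∀ x ∈ nodes T, u <+: x → x <+: v → x = u ∨ x = v

/-- A node is good if its implicit suffix link is a node; the root is bad. -/
def Good (T : List (PSym S Q)) (u : List (PvSym S)) : Prop :=
  u ∈ nodes T ∧ u ≠ [] ∧ sl u ∈ nodes T

/-- The position `|u| + r` (counted from `1`) of `v` refers to the first symbol of `v`, and
lies below `u`. -/
def RefersToFirst (u v : List (PvSym S)) (r : ℕ) : Prop :=
  1 ≤ r ∧ v[u.length + r - 1]? = some (Sum.inr (u.length + r - 1))

/-- `r` is the re-encoding sign of the node `v` with parent `u`. -/
def IsReSign (u v : List (PvSym S)) (r : ℕ) : Prop :=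
  RefersToFirst u v r ∨ (r = 0 ∧ ∀ r', ¬ RefersToFirst u v r')

/-- The fast link of the edge `(u, v)` may stop after `k` suffix links: the child `x` of
`slᵏ(u)` in the direction of `slᵏ(v)` ends strictly above `slᵏ(v)`, or has a positive
re-encoding sign, or the edge from `slᵏ(u)` to `x` has a bad endpoint. -/
def FastStop (T : List (PSym S Q)) (u v : List (PvSym S)) (k : ℕ) : Prop :=
  ∃ x, IsEdge T (sl^[k] u) x ∧
    x[(sl^[k] u).length]? = (sl^[k] v)[(sl^[k] u).length]? ∧
    (x.length < (sl^[k] v).length ∨ (∃ r, 0 < r ∧ IsReSign (sl^[k] u) x r) ∨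
      ¬ Good T (sl^[k] u) ∨ ¬ Good T x)

/-- `w` is the fast link of the edge `(u, v)`. -/
def IsFastLink (T : List (PSym S Q)) (u v w : List (PvSym S)) : Prop :=
  ∃ k, 1 ≤ k ∧ w = sl^[k] u ∧ FastStop T u v k ∧ ∀ j, 1 ≤ j → j < k → ¬ FastStop T u v j

end Strings

/-! ### The data structure -/

/-- Edge labels: one symbol, or a reference `(i, j, k)` into the stored text. -/
inductive Label (S : Type*) where
  | sym (a : PvSym S) : Label S
  | ref (i j : ℕ) (k : ℤ) : Label S

/-- An entry of the list of children of a node; `ν` is the type of pointers to nodes. -/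
structure Edge (S ν : Type*) where
  target : ν
  label : Label S
  fast : Option ν

/-- The stored data. Nodes are pointers and do not carry the strings they stand for. -/
structure Data (S ν : Type*) where
  root : ν
  depth : ν → ℕ
  slink : ν → Option ν
  re : ν → ℕ
  children : ν → List (Edge S ν)
  text : List (PvSym S)

/-- `D` is `PLST(T)` with fast links, where `str u` is the string that the pointer `u`
stands for. -/
structure Represents {S Q ν : Type*} [DecidableEq S] [DecidableEq Q]
    (T : List (PSym S Q)) (D : Data S ν) (str : ν → List (PvSym S)) : Prop where
  str_injective : Function.Injective str
  range_str : Set.range str = nodes T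
  str_root : str D.root = []
  depth_eq : ∀ u, D.depth u = (str u).length
  slink_eq : ∀ u w, D.slink u = some w ↔ str u ≠ [] ∧ str w = sl (str u)
  re_sign : ∀ u v, IsEdge T (str u) (str v) → IsReSign (str u) (str v) (D.re v)
  children_nodup : ∀ u, ((D.children u).map Edge.target).Nodup
  children_iff : ∀ u v, v ∈ (D.children u).map Edge.target ↔ IsEdge T (str u) (str v)
  label_sym : ∀ u, ∀ g ∈ D.children u, ∀ a, g.label = Label.sym a →
    ((Good T (str u) ∧ Good T (str g.target)) ∨
        (str g.target).length = (str u).length + 1) ∧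
      (str g.target)[(str u).length]? = some a
  label_ref : ∀ u, ∀ g ∈ D.children u, ∀ i j k, g.label = Label.ref i j k →
    ¬ ((Good T (str u) ∧ Good T (str g.target)) ∨
        (str g.target).length = (str u).length + 1) ∧
      1 ≤ i ∧ j ≤ D.text.length ∧
      ((reencode k D.text).take j).drop (i - 1) = (str g.target).drop (str u).length
  fast_link : ∀ u, ∀ g ∈ D.children u, Good T (str u) → Good T (str g.target) →
    (str u).length + 1 < (str g.target).length →
    ∃ w, g.fast = some w ∧ IsFastLink T (str u) (str g.target) (str w)
  text_sublist : D.text.Sublist (prevEnc T)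

/-! ### The matching algorithm as a machine with unit-cost steps

The machine prev-encodes the pattern into an array and then runs `P-Match` with fast links
from the root. A subword of the array is given by the interval `[s, e)` of its positions.
Every transition makes a bounded number of array, table, pointer and arithmetic operations
on single cells. -/

/-- Control states of the machine. -/
inductive Ctl (S Q ν : Type*) where
  /-- prev-encode from position `i` on; `last` holds the last position of each parameter -/
  | enc (i : ℕ) (last : Q → Option ℕ) : Ctl S Q ν
  /-- `P-Match(p[s, e), u)` is called -/
  | call (s e : ℕ) (u : ν) : Ctl S Q ν
  /-- search the remaining entries for the child of `u` whose edge begins with `p[s]` -/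
  | scan (s e : ℕ) (u : ν) (rest : List (Edge S ν)) : Ctl S Q ν
  /-- the child has been found -/
  | edge (s e : ℕ) (u : ν) (g : Edge S ν) : Ctl S Q ν
  /-- compare `p[s, t)` with the stored text re-encoded by `k`, from its position `i` on, and
  then call `P-Match(p[t, e), v)` -/
  | cmp (s t e : ℕ) (v : ν) (i : ℕ) (k : ℤ) : Ctl S Q ν
  /-- the current call returns `r`, where `none` is the null value -/
  | ret (r : Option ν) : Ctl S Q ν
  /-- the machine has halted with the value `r` -/
  | done (r : Option ν) : Ctl S Q ν

/-- Configurations: control state, array, stack of pending calls `P-Match(p[s, e), v)`, and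
the number of fast links followed so far. -/
structure Config (S Q ν : Type*) where
  ctl : Ctl S Q ν
  arr : ℕ → PvSym S
  stack : List (ℕ × ℕ × ν)
  hops : ℕ

section Machine

variable {S Q ν : Type*} [DecidableEq S] [DecidableEq Q]

/-- The symbol at position `i` (counted from `1`) of the stored text, re-encoded by `k`. -/
def Data.textSym (D : Data S ν) (i : ℕ) (k : ℤ) : PvSym S :=
  reSym k i (D.text.getD (i - 1) (Sum.inr 0))

/-- The first symbol of an edge. -/
def Data.firstSym (D : Data S ν) (g : Edge S ν) : PvSym S :=
  match g.label with
  | Label.sym a => a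
  | Label.ref i _ k => D.textSym i k

/-- Follow the fast link of the edge `g` with the subword `p[s, t)`; afterwards
`P-Match(p[t, e), v)` remains to be called, where `v` is the end of `g`. -/
def follow (s t e : ℕ) (g : Edge S ν) (c : Config S Q ν) : Config S Q ν :=
  match g.fast with
  | none => { c with ctl := Ctl.ret none }
  | some w =>
    { c with
      ctl := Ctl.call s t w
      stack := (t, e, g.target) :: c.stack
      hops := c.hops + 1 }

/-- Process the edge `g` from `u` to the child of `u` selected by `p[s]`. -/
def edgeStep (D : Data S ν) (s e : ℕ) (u : ν) (g : Edge S ν) (c : Config S Q ν) :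
    Config S Q ν :=
  let v := g.target
  let l := min (e - s) (D.depth v - D.depth u)
  if l < 2 then
    { c with ctl := Ctl.call (s + l) e v }
  else if (D.slink u).isNone || (D.slink v).isNone then
    match g.label with
    | Label.sym _ => { c with ctl := Ctl.ret none }
    | Label.ref i _ k => { c with ctl := Ctl.cmp s (s + l) e v i k }
  else if 1 ≤ D.re v ∧ D.re v ≤ e - s then
    if c.arr (s + D.re v - 1) = Sum.inr (D.depth u + D.re v - 1) then
      follow s (s + l) e g
        { c with arr := Function.update c.arr (s + D.re v - 1) (Sum.inr 0) }
    else
      { c with ctl := Ctl.ret none }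
  else
    follow s (s + l) e g c

/-- One step of the machine on the data `D` and the pattern `P`. -/
def step (D : Data S ν) (P : List (PSym S Q)) (c : Config S Q ν) : Config S Q ν :=
  match c.ctl with
  | Ctl.enc i last =>
    match P[i]? with
    | none => { c with ctl := Ctl.call 0 i D.root }
    | some (Sum.inl a) =>
      { c with
        ctl := Ctl.enc (i + 1) last
        arr := Function.update c.arr i (Sum.inl a) }
    | some (Sum.inr x) =>
      let d := match last x with
        | none => 0
        | some k => i - k
      { c with
        ctl := Ctl.enc (i + 1) (Function.update last x (some i))
        arr := Function.update c.arr i (Sum.inr d) }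
  | Ctl.call s e u =>
    if s = e then { c with ctl := Ctl.ret (some u) }
    else { c with ctl := Ctl.scan s e u (D.children u) }
  | Ctl.scan _ _ _ [] => { c with ctl := Ctl.ret none }
  | Ctl.scan s e u (g :: rest) =>
    if D.firstSym g = c.arr s then { c with ctl := Ctl.edge s e u g }
    else { c with ctl := Ctl.scan s e u rest }
  | Ctl.edge s e u g => edgeStep D s e u g c
  | Ctl.cmp s t e v i k =>
    if s = t then { c with ctl := Ctl.call t e v }
    else if c.arr s = D.textSym i k then { c with ctl := Ctl.cmp (s + 1) t e v (i + 1) k }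
    else { c with ctl := Ctl.ret none }
  | Ctl.ret r =>
    match c.stack, r with
    | [], r => { c with ctl := Ctl.done r }
    | _ :: fs, none => { c with ctl := Ctl.ret none, stack := fs }
    | (s, e, v) :: fs, some _ => { c with ctl := Ctl.call s e v, stack := fs }
  | Ctl.done _ => c

/-- The initial configuration of a run on a pattern. -/
def initial : Config S Q ν where
  ctl := Ctl.enc 0 (fun _ => none)
  arr := fun _ => Sum.inr 0
  stack := []
  hops := 0

/-- The configuration in which `P-Match(p, u)` is called from outside. -/
def callConfig (p : List (PvSym S)) (u : ν) : Config S Q ν where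
  ctl := Ctl.call 0 p.length u
  arr := fun i => p.getD i (Sum.inr 0)
  stack := []
  hops := 0

end Machine

end PLST

/-!
A string `u` over constants and numbers is read as a string of the trie of prev-encodings of
substrings of `T`. Two p-strings p-match if and only if their prev-encodings agree
(`pMatch_iff_prevEnc_eq`), so it has to be shown that `P-Match(p, ε)` decides whether the
prev-encoding `p` of the pattern lies in the trie.

*Correctness.* For an arbitrary string `p`, the call `P-Match(p, u)` succeeds if and only if
`u ++ p` lies in the trie. Along an edge `(u, v)` the trie does not branch, so the first symbol of
`p` determines all others (`Unbranched.append_mem_iff`). If `u` is not the root, then the trie does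
not branch between `sl u` and `sl v` either: a branching node there would be the suffix link of a
string inside the edge, which would then be a node of Type 1 or Type 2 (`IsEdge.unbranched_sl`).
Hence, once the only symbol that the suffix link changes has been checked, `p` can as well be
compared below `sl u`. The fast link iterates suffix links as long as they lead from edges to edges
and change no symbol (`IsFastLink.fastTarget`).

*Cost.* Let `weight p` be the number of positive numbers in `p`. If `p` is not empty and
leads from a node to a node, then the number `h` of fast links satisfies `h + 1 ≤ |p| + weight p`:
the path at which a fast link arrives either consists of several edges, which gains one when the
bounds for these edges are added, or it is an edge whose positive re-encoding sign will
lower the weight, or it is an edge with a bad endpoint, which needs no fast link at all.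
For a pattern that ends inside an edge or does not occur, there is the bound
`2 * |p| + weight p + |u|`, since each fast link decreases the depth of the current node. At
the root this is at most `3 * m`. All other steps are charged to fast links or to symbols of the
pattern, as a node has boundedly many children (`exists_finset_of_extensions`). The structure
`Outcome` collects these claims, and `exists_outcome` proves them by induction on the length of
`p` and the depth of `u`.
-/

namespace PLST

/-! ### Prev-encoding -/

theorem exists_inr_of_fixes_inl {S Q : Type*} {f : Equiv.Perm (PSym S Q)}
    (hf : ∀ a : S, f (Sum.inl a) = Sum.inl a) (x : Q) : ∃ y, f (Sum.inr x) = Sum.inr y := by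
  rcases h : f (Sum.inr x) with a | y
  · rw [← hf a] at h
    exact absurd (f.injective h) (by simp)
  · exact ⟨y, rfl⟩

section Encoding

variable {S Q : Type*} [DecidableEq S] [DecidableEq Q]

/-- The last position before `i` at which the parameter `x` occurs in `w`. -/
def lastOcc (w : List (PSym S Q)) (i : ℕ) (x : Q) : Option ℕ :=
  ((List.range i).filter (fun j => w[j]? = some (Sum.inr x))).max?

theorem prevDist_eq_match (w : List (PSym S Q)) (i : ℕ) (x : Q) :
    prevDist w i x = match lastOcc w i x with
      | none => 0
      | some k => i - k := rfl

theorem lastOcc_eq_none_iff {w : List (PSym S Q)} {i : ℕ} {x : Q} :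
    lastOcc w i x = none ↔ ∀ j < i, w[j]? ≠ some (Sum.inr x) := by
  simp [lastOcc, List.max?_eq_none_iff, List.filter_eq_nil_iff]

theorem lastOcc_eq_some_iff {w : List (PSym S Q)} {i k : ℕ} {x : Q} :
    lastOcc w i x = some k ↔
      k < i ∧ w[k]? = some (Sum.inr x) ∧ ∀ j, k < j → j < i → w[j]? ≠ some (Sum.inr x) := by
  rw [lastOcc, List.max?_eq_some_iff]
  simp only [List.mem_filter, List.mem_range, decide_eq_true_eq, and_imp]
  constructor
  · rintro ⟨⟨h1, h2⟩, h3⟩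
    exact ⟨h1, h2, fun j hk hj h => absurd (h3 j hj h) (by omega)⟩
  · rintro ⟨h1, h2, h3⟩
    exact ⟨⟨h1, h2⟩, fun j hj h => by
      by_contra hc
      exact h3 j (by omega) hj h⟩

theorem lastOcc_congr {w w' : List (PSym S Q)} {i : ℕ} {x y : Q}
    (h : ∀ j < i, w[j]? = some (Sum.inr x) ↔ w'[j]? = some (Sum.inr y)) :
    lastOcc w i x = lastOcc w' i y := by
  unfold lastOcc
  congr 1
  apply List.filter_congr
  intro j hj
  simp only [h j (List.mem_range.1 hj)]

theorem prevDist_congr {w w' : List (PSym S Q)} {i : ℕ} {x y : Q}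
    (h : ∀ j < i, w[j]? = some (Sum.inr x) ↔ w'[j]? = some (Sum.inr y)) :
    prevDist w i x = prevDist w' i y := by
  rw [prevDist_eq_match, prevDist_eq_match, lastOcc_congr h]

theorem prevDist_eq_zero_iff {w : List (PSym S Q)} {i : ℕ} {x : Q} :
    prevDist w i x = 0 ↔ ∀ j < i, w[j]? ≠ some (Sum.inr x) := by
  rw [prevDist_eq_match, ← lastOcc_eq_none_iff]
  rcases h : lastOcc w i x with _ | k
  · simp
  · have := (lastOcc_eq_some_iff.1 h).1
    simp only [reduceCtorEq, iff_false]
    omega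

theorem prevDist_eq_pos_iff {w : List (PSym S Q)} {i d : ℕ} {x : Q} (hd : 0 < d) :
    prevDist w i x = d ↔ d ≤ i ∧ w[i - d]? = some (Sum.inr x) ∧
      ∀ j, i - d < j → j < i → w[j]? ≠ some (Sum.inr x) := by
  rw [prevDist_eq_match]
  rcases h : lastOcc w i x with _ | k
  · simp only
    constructor
    · omega
    · rintro ⟨h1, h2, -⟩
      exact absurd h2 (lastOcc_eq_none_iff.1 h _ (by omega))
  · have hk := lastOcc_eq_some_iff.1 h
    simp only
    constructor
    · intro he
      have : i - d = k := by omega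
      rw [this]
      exact ⟨by omega, hk.2⟩
    · rintro ⟨h1, h2, h3⟩
      have := lastOcc_eq_some_iff.2 ⟨by omega, h2, h3⟩
      rw [h] at this
      have := Option.some.inj this
      omega

theorem prevDist_le (w : List (PSym S Q)) (i : ℕ) (x : Q) : prevDist w i x ≤ i := by
  rcases Nat.eq_zero_or_pos (prevDist w i x) with h | h
  · omega
  · exact ((prevDist_eq_pos_iff h).1 rfl).1

/-- The symbol that the prev-encoding of `w` has at position `i`, if `w` has `c` there. -/
def encSym (w : List (PSym S Q)) (i : ℕ) (c : PSym S Q) : PvSym S :=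
  match c with
  | Sum.inl a => Sum.inl a
  | Sum.inr x => Sum.inr (prevDist w i x)

@[simp]
theorem length_prevEnc (w : List (PSym S Q)) : (prevEnc w).length = w.length := by
  simp [prevEnc]

theorem getElem?_prevEnc (w : List (PSym S Q)) (i : ℕ) :
    (prevEnc w)[i]? = (w[i]?).map (encSym w i) := by
  simp only [prevEnc, List.getElem?_mapIdx]
  rfl

theorem encSym_congr {w w' : List (PSym S Q)} {i : ℕ} (h : ∀ j < i, w[j]? = w'[j]?)
    (c : PSym S Q) : encSym w i c = encSym w' i c := by
  rcases c with a | x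
  · rfl
  · exact congrArg Sum.inr (prevDist_congr fun j hj => by rw [h j hj])

theorem prevEnc_append_singleton (w : List (PSym S Q)) (c : PSym S Q) :
    prevEnc (w ++ [c]) = prevEnc w ++ [encSym w w.length c] := by
  apply List.ext_getElem?
  intro i
  rw [getElem?_prevEnc, List.getElem?_append, List.getElem?_append, length_prevEnc]
  split_ifs with h
  · rw [getElem?_prevEnc]
    congr 1
    funext c'
    exact encSym_congr (fun j hj => List.getElem?_append_left (by omega)) c'
  · rcases Nat.eq_or_lt_of_le (not_lt.1 h) with rfl | h'
    · simp only [Nat.sub_self, List.getElem?_cons_zero, Option.map_some]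
      exact congrArg some (encSym_congr (fun j hj => List.getElem?_append_left (by omega)) c)
    · have : i - w.length ≠ 0 := by omega
      simp [this]

theorem prevEnc_take (w : List (PSym S Q)) (n : ℕ) : prevEnc (w.take n) = (prevEnc w).take n := by
  apply List.ext_getElem?
  intro i
  rw [getElem?_prevEnc, List.getElem?_take, List.getElem?_take]
  split_ifs with h
  · rw [getElem?_prevEnc]
    congr 1
    funext c
    exact encSym_congr (fun j hj => by rw [List.getElem?_take, if_pos (by omega)]) c
  · rfl

theorem prevEnc_map {f : Equiv.Perm (PSym S Q)} (hf : ∀ a : S, f (Sum.inl a) = Sum.inl a)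
    (w : List (PSym S Q)) : prevEnc (w.map f) = prevEnc w := by
  apply List.ext_getElem?
  intro i
  rw [getElem?_prevEnc, getElem?_prevEnc, List.getElem?_map, Option.map_map]
  congr 1
  funext c
  rcases c with a | x
  · simp [Function.comp, hf, encSym]
  · obtain ⟨y, hy⟩ := exists_inr_of_fixes_inl hf x
    simp only [Function.comp, hy, encSym]
    refine congrArg Sum.inr (prevDist_congr fun j _ => ?_)
    rw [List.getElem?_map, ← hy]
    rcases w[j]? with _ | b
    · simp
    · simp

theorem PMatch.of_prevEnc_eq {w₁ : List (PSym S Q)} :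
    ∀ {w₂ : List (PSym S Q)}, prevEnc w₁ = prevEnc w₂ → PMatch w₁ w₂ := by
  induction w₁ using List.reverseRecOn with
  | nil =>
    intro w₂ h
    have := congrArg List.length h
    simp only [length_prevEnc, List.length_nil] at this
    exact ⟨1, fun _ => rfl, by simp [List.eq_nil_of_length_eq_zero this.symm]⟩
  | append_singleton w c ih =>
    intro w₂ h
    rcases List.eq_nil_or_concat w₂ with rfl | ⟨w', c', rfl⟩
    · have := congrArg List.length h
      simp at this
    rw [List.concat_eq_append, prevEnc_append_singleton, prevEnc_append_singleton] at h
    obtain ⟨h1, h2⟩ := List.append_inj' h rfl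
    obtain ⟨f, hf, rfl⟩ := ih h1
    simp only [List.cons.injEq, and_true, List.length_map] at h2
    rw [List.concat_eq_append]
    rcases c with a | x
    · rcases c' with a' | x'
      · simp only [encSym, Sum.inl.injEq] at h2
        exact ⟨f, hf, by simp [hf, h2]⟩
      · simp [encSym] at h2
    rcases c' with a' | x'
    · simp [encSym] at h2
    simp only [encSym, Sum.inr.injEq] at h2
    obtain ⟨y, hy⟩ := exists_inr_of_fixes_inl hf x
    rcases Nat.eq_zero_or_pos (prevDist w w.length x) with h0 | h0
    · -- Both parameters are new, so the permutation can be corrected by a transposition.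
      have hx := prevDist_eq_zero_iff.1 h0
      have hx' := prevDist_eq_zero_iff.1 (h2 ▸ h0)
      refine ⟨f.trans (Equiv.swap (Sum.inr y) (Sum.inr x')), fun a => ?_, ?_⟩
      · simp [hf, Equiv.swap_apply_of_ne_of_ne]
      · simp only [List.map_append, List.map_cons, List.map_nil, Equiv.coe_trans,
          Function.comp, hy, Equiv.swap_apply_left]
        congr 1
        apply List.map_congr_left
        intro b hb
        obtain ⟨j, hj, rfl⟩ := List.getElem_of_mem hb
        apply Equiv.swap_apply_of_ne_of_ne
        · intro he
          rw [← hy] at he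
          apply hx j hj
          rw [List.getElem?_eq_getElem hj, f.injective he]
        · intro he
          apply hx' j hj
          rw [List.getElem?_map, List.getElem?_eq_getElem hj, Option.map_some, he]
    · have hx := ((prevDist_eq_pos_iff h0).1 rfl).2.1
      have hx' := ((prevDist_eq_pos_iff h0).1 h2.symm).2.1
      rw [List.getElem?_map, hx, Option.map_some, Option.some.injEq] at hx'
      exact ⟨f, hf, by simp [hx']⟩

theorem pMatch_iff_prevEnc_eq {w₁ w₂ : List (PSym S Q)} :
    PMatch w₁ w₂ ↔ prevEnc w₁ = prevEnc w₂ := by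
  refine ⟨?_, PMatch.of_prevEnc_eq⟩
  rintro ⟨f, hf, rfl⟩
  exact (prevEnc_map hf w₁).symm

/-- The distances in a prev-encoding do not lead out of the string. -/
theorem le_of_getElem?_prevEnc {w : List (PSym S Q)} {i d : ℕ}
    (h : (prevEnc w)[i]? = some (Sum.inr d)) : d ≤ i := by
  rw [getElem?_prevEnc, Option.map_eq_some_iff] at h
  obtain ⟨c, -, hc⟩ := h
  rcases c with a | x
  · simp [encSym] at hc
  · simp only [encSym, Sum.inr.injEq] at hc
    exact hc ▸ prevDist_le w i x

/-- At most one later position of a prev-encoding refers to the first position. -/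
theorem refersToFirst_unique {w : List (PSym S Q)} {i j : ℕ} (hi : 0 < i) (hj : 0 < j)
    (h1 : (prevEnc w)[i]? = some (Sum.inr i)) (h2 : (prevEnc w)[j]? = some (Sum.inr j)) :
    i = j := by
  have key : ∀ {i j : ℕ}, 0 < i → (prevEnc w)[i]? = some (Sum.inr i) →
      (prevEnc w)[j]? = some (Sum.inr j) → ¬ i < j := by
    intro i j hi h1 h2 hij
    rw [getElem?_prevEnc, Option.map_eq_some_iff] at h1 h2
    obtain ⟨c, hc, hc'⟩ := h1
    obtain ⟨b, hb, hb'⟩ := h2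
    rcases c with a | x
    · simp [encSym] at hc'
    rcases b with a | y
    · simp [encSym] at hb'
    simp only [encSym, Sum.inr.injEq] at hc' hb'
    have hx := (prevDist_eq_pos_iff hi).1 hc'
    have hy := (prevDist_eq_pos_iff (by omega)).1 hb'
    have e1 := hx.2.1
    have e2 := hy.2.1
    rw [Nat.sub_self] at e1 e2
    rw [e1, Option.some.injEq, Sum.inr.injEq] at e2
    exact hy.2.2 i (by omega) hij (e2 ▸ hc)
  have := key hi h1 h2
  have := key hj h2 h1
  omega

end Encoding

/-! ### Suffix links and re-encoding signs -/

section Relabel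

variable {S : Type*}

theorem length_sl (u : List (PvSym S)) : (sl u).length = u.length - 1 := by
  simp [sl, reencode]

theorem getElem?_sl (u : List (PvSym S)) (i : ℕ) :
    (sl u)[i]? = (u[i + 1]?).map (reSym 1 (i + 1)) := by
  simp [sl, reencode, List.getElem?_mapIdx, List.getElem?_tail]

theorem sl_take (u : List (PvSym S)) (n : ℕ) : sl (u.take (n + 1)) = (sl u).take n := by
  apply List.ext_getElem?
  intro i
  simp only [getElem?_sl, List.getElem?_take, Nat.add_lt_add_iff_right]
  split_ifs <;> rfl

theorem exists_isReSign (u v : List (PvSym S)) : ∃ r, IsReSign u v r := by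
  by_cases h : ∃ r, RefersToFirst u v r
  · exact ⟨h.choose, Or.inl h.choose_spec⟩
  · exact ⟨0, Or.inr ⟨rfl, fun r hr => h ⟨r, hr⟩⟩⟩

theorem IsReSign.eq_zero {u v : List (PvSym S)} {r : ℕ} (hr : IsReSign u v r)
    (h : ∀ r, 0 < r → ¬ IsReSign u v r) : r = 0 := by
  by_contra h0
  exact h r (Nat.pos_of_ne_zero h0) hr

/-- The effect on the label of an edge of taking the suffix link, if the re-encoding sign of
the edge is `r`. -/
def relabel (r : ℕ) (s : List (PvSym S)) : List (PvSym S) :=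
  if r = 0 then s else s.set (r - 1) (Sum.inr 0)

@[simp]
theorem length_relabel (r : ℕ) (s : List (PvSym S)) : (relabel r s).length = s.length := by
  unfold relabel
  split_ifs <;> simp

theorem getElem?_relabel (r : ℕ) (s : List (PvSym S)) (i : ℕ) :
    (relabel r s)[i]? = if i + 1 = r then (s[i]?).map (fun _ => Sum.inr 0) else s[i]? := by
  unfold relabel
  split_ifs with h1 h2 h2
  · omega
  · rfl
  · subst h2
    rw [Nat.add_sub_cancel, List.getElem?_set_self']
    rfl
  · rw [List.getElem?_set_ne (by omega)]

end Relabel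

/-! ### The trie of prev-encodings and its nodes -/

section Trie

variable {S Q : Type*} [DecidableEq S] [DecidableEq Q] {T : List (PSym S Q)}

theorem mem_prevSub_of_prefix {x y : List (PvSym S)} (hy : y ∈ PrevSub T) (h : x <+: y) :
    x ∈ PrevSub T := by
  obtain ⟨w, hw, rfl⟩ := hy
  refine ⟨w.take x.length, (List.take_prefix _ _).isInfix.trans hw, ?_⟩
  rw [prevEnc_take]
  exact (List.prefix_iff_eq_take.1 h).symm

theorem nil_mem_prevSub : [] ∈ PrevSub T := ⟨[], List.nil_infix, rfl⟩

theorem length_le_of_mem_prevSub {x : List (PvSym S)} (hx : x ∈ PrevSub T) :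
    x.length ≤ T.length := by
  obtain ⟨w, hw, rfl⟩ := hx
  rw [length_prevEnc]
  exact hw.length_le

theorem le_of_mem_prevSub {x : List (PvSym S)} (hx : x ∈ PrevSub T) {i d : ℕ}
    (h : x[i]? = some (Sum.inr d)) : d ≤ i := by
  obtain ⟨w, -, rfl⟩ := hx
  exact le_of_getElem?_prevEnc h

theorem mem_prevSub_of_mem_nodes {x : List (PvSym S)} (hx : x ∈ nodes T) : x ∈ PrevSub T := by
  rcases hx with (rfl | hx) | hx
  · exact nil_mem_prevSub
  · exact hx.1
  · exact hx.1

theorem mem_nodes_of_mem_typeOne {x : List (PvSym S)} (hx : x ∈ TypeOne T) : x ∈ nodes T :=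
  Or.inl (Or.inr hx)

theorem mem_nodes_of_sl_mem_typeOne {x : List (PvSym S)} (hx : x ∈ PrevSub T) (h0 : x ≠ [])
    (h : sl x ∈ TypeOne T) : x ∈ nodes T := by
  by_cases h1 : x ∈ TypeOne T
  · exact mem_nodes_of_mem_typeOne h1
  · exact Or.inr ⟨hx, h1, h0, h⟩

/-- A longest extension of a string of the trie is a leaf. -/
theorem exists_typeOne_extension {x : List (PvSym S)} (hx : x ∈ PrevSub T) :
    ∃ y ∈ TypeOne T, x <+: y := by
  induction h : T.length - x.length using Nat.strong_induction_on generalizing x with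
  | _ n ih =>
    by_cases hl : ∀ a, x ++ [a] ∉ PrevSub T
    · exact ⟨x, ⟨hx, Or.inl hl⟩, List.prefix_rfl⟩
    · push Not at hl
      obtain ⟨a, ha⟩ := hl
      have h1 := length_le_of_mem_prevSub ha
      simp only [List.length_append, List.length_singleton] at h1
      obtain ⟨y, hy, hxy⟩ := ih _ (by simp only [List.length_append, List.length_singleton]; omega)
        ha rfl
      exact ⟨y, hy, (List.prefix_append _ _).trans hxy⟩

/-- No leaf or branching node of the trie lies strictly between `x` and `y`. -/
def Unbranched (T : List (PSym S Q)) (x y : List (PvSym S)) : Prop :=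
  ∀ z ∈ TypeOne T, x <+: z → z <+: y → z = x ∨ z = y

/-- On a path without branching the first symbol determines the others. -/
theorem Unbranched.append_mem_iff {x s : List (PvSym S)} (hb : Unbranched T x (x ++ s))
    (hy : x ++ s ∈ PrevSub T) {p : List (PvSym S)} (h0 : p[0]? = s[0]?)
    (hl : p.length ≤ s.length) : x ++ p ∈ PrevSub T ↔ p <+: s := by
  refine ⟨fun h => ?_, fun h => mem_prevSub_of_prefix hy ((List.prefix_append_right_inj _).2 h)⟩
  induction p using List.reverseRecOn with
  | nil => exact List.nil_prefix
  | append_singleton p a ih =>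
    simp only [List.length_append, List.length_singleton] at hl
    have hs : p.length < s.length := by omega
    rcases eq_or_ne p [] with rfl | hne
    · rw [List.nil_append] at h0 ⊢
      obtain ⟨c, s', rfl⟩ := List.exists_cons_of_length_pos hs
      simp only [List.getElem?_cons_zero, Option.some.injEq] at h0
      exact ⟨s', by simp [h0]⟩
    · have hlp := List.length_pos_iff.2 hne
      rw [← List.append_assoc] at h
      have hp : p <+: s := ih (by rwa [List.getElem?_append_left hlp] at h0) (by omega)
        (mem_prevSub_of_prefix h (List.prefix_append _ _))
      obtain ⟨s', rfl⟩ := hp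
      rcases s' with _ | ⟨b, s'⟩
      · simp at hs
      by_cases hab : a = b
      · exact ⟨s', by simp [hab]⟩
      · exfalso
        have hb' : (x ++ p) ++ [b] ∈ PrevSub T := mem_prevSub_of_prefix hy ⟨s', by simp⟩
        rcases hb (x ++ p)
          ⟨mem_prevSub_of_prefix h (List.prefix_append _ _), Or.inr ⟨a, b, hab, h, hb'⟩⟩
          (List.prefix_append _ _) ⟨b :: s', by simp⟩ with he | he
        · exact hne (by simpa using he)
        · have := congrArg List.length he
          simp at this

theorem IsEdge.unbranched {u v : List (PvSym S)} (h : IsEdge T u v) : Unbranched T u v :=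
  fun z hz => h.2.2.2.2 z (mem_nodes_of_mem_typeOne hz)

theorem IsEdge.length_lt {u v : List (PvSym S)} (h : IsEdge T u v) : u.length < v.length := by
  refine lt_of_le_of_ne h.2.2.1.length_le fun he => h.2.2.2.1 (h.2.2.1.eq_of_length he)

/-- The suffix links of the ends of an edge enclose no branching node: it would be the suffix
link of a string inside the edge, which would be a node of Type 1 or Type 2. -/
theorem IsEdge.unbranched_sl {u v : List (PvSym S)} (h : IsEdge T u v) (hu : u ≠ []) :
    Unbranched T (sl u) (sl v) := by
  intro z hz h1 h2
  have hu' := List.length_pos_iff.2 hu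
  have hv := h.length_lt
  have hl1 := h1.length_le
  have hl2 := h2.length_le
  rw [length_sl] at hl1 hl2
  have hs : sl (v.take (z.length + 1)) = z := by
    rw [sl_take]
    exact (List.prefix_iff_eq_take.1 h2).symm
  have hpre : v.take (z.length + 1) <+: v := List.take_prefix _ _
  have hlen : (v.take (z.length + 1)).length = z.length + 1 := by
    rw [List.length_take]
    omega
  have hne : v.take (z.length + 1) ≠ [] := by
    rw [← List.length_pos_iff]
    omega
  have hn := mem_nodes_of_sl_mem_typeOne
    (mem_prevSub_of_prefix (mem_prevSub_of_mem_nodes h.2.1) hpre) hne (hs.symm ▸ hz)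
  rcases h.2.2.2.2 _ hn (List.prefix_of_prefix_length_le h.2.2.1 hpre (by omega)) hpre with he | he
  · exact Or.inl (by rw [← hs, he])
  · exact Or.inr (by rw [← hs, he])

/-- Below a node, the path to any lower node starts with an edge. -/
theorem exists_edge {u y : List (PvSym S)} (hu : u ∈ nodes T) (hy : y ∈ nodes T)
    (huy : u <+: y) (hne : u ≠ y) : ∃ x, IsEdge T u x ∧ x <+: y := by
  classical
  have hlt : u.length < y.length :=
    lt_of_le_of_ne huy.length_le fun he => hne (huy.eq_of_length he)
  have hex : ∃ n, u.length < n ∧ y.take n ∈ nodes T := ⟨y.length, hlt, by rwa [List.take_length]⟩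
  obtain ⟨h1, h2⟩ := Nat.find_spec hex
  have hn : Nat.find hex ≤ y.length := Nat.find_min' hex ⟨hlt, by rwa [List.take_length]⟩
  have hp : y.take (Nat.find hex) <+: y := List.take_prefix _ _
  have hlen : (y.take (Nat.find hex)).length = Nat.find hex := by
    rw [List.length_take]
    omega
  refine ⟨y.take (Nat.find hex), ⟨hu, h2, List.prefix_of_prefix_length_le huy hp (by omega),
    fun he => ?_, fun z hz hz1 hz2 => ?_⟩, hp⟩
  · have := congrArg List.length he
    omega
  · by_contra hc
    push Not at hc
    have hl1 : u.length < z.length :=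
      lt_of_le_of_ne hz1.length_le fun he => hc.1 (hz1.eq_of_length he).symm
    have hl2 : z.length < Nat.find hex := by
      rw [← hlen]
      exact lt_of_le_of_ne hz2.length_le fun he => hc.2 (hz2.eq_of_length he)
    apply Nat.find_min hex hl2
    refine ⟨hl1, ?_⟩
    rwa [← List.prefix_iff_eq_take.1 (hz2.trans hp)]

theorem getElem?_of_prefix {α : Type*} {x y : List α} (h : x <+: y) {i : ℕ} (hi : i < x.length) :
    y[i]? = x[i]? := by
  obtain ⟨z, rfl⟩ := h
  exact List.getElem?_append_left hi

theorem IsEdge.prefix_of_edge {u x y : List (PvSym S)} (hx : IsEdge T u x) (hy : IsEdge T u y)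
    (h0 : x[u.length]? = y[u.length]?) (hl : x.length ≤ y.length) : x <+: y := by
  obtain ⟨p, rfl⟩ := hx.2.2.1
  obtain ⟨s, rfl⟩ := hy.2.2.1
  rw [List.prefix_append_right_inj]
  refine (hy.unbranched.append_mem_iff (mem_prevSub_of_mem_nodes hy.2.1) ?_ ?_).1
    (mem_prevSub_of_mem_nodes hx.2.1)
  · simpa [List.getElem?_append_right] using h0
  · simpa using hl

/-- Different edges from one node start with different symbols. -/
theorem IsEdge.eq_of_edge {u x y : List (PvSym S)} (hx : IsEdge T u x) (hy : IsEdge T u y)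
    (h0 : x[u.length]? = y[u.length]?) : x = y := by
  rcases le_total x.length y.length with hl | hl
  · rcases hy.2.2.2.2 x hx.2.1 hx.2.2.1 (hx.prefix_of_edge hy h0 hl) with h | h
    · exact absurd h.symm hx.2.2.2.1
    · exact h
  · rcases hx.2.2.2.2 y hy.2.1 hy.2.2.1 (hy.prefix_of_edge hx h0.symm hl) with h | h
    · exact absurd h.symm hy.2.2.2.1
    · exact h.symm

theorem IsEdge.prefix_of_node {u x y : List (PvSym S)} (hx : IsEdge T u x) (hy : y ∈ nodes T)
    (huy : u <+: y) (hne : u ≠ y) (h0 : x[u.length]? = y[u.length]?) : x <+: y := by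
  obtain ⟨z, hz, hzy⟩ := exists_edge hx.1 hy huy hne
  rwa [hx.eq_of_edge hz (by rw [h0, getElem?_of_prefix hzy hz.length_lt])]

/-- If no edge from a node starts with the first symbol of `p`, then `p` does not occur below this
node. -/
theorem exists_edge_of_append_mem {u p : List (PvSym S)} (hu : u ∈ nodes T) (hp : p ≠ [])
    (h : u ++ p ∈ PrevSub T) : ∃ x, IsEdge T u x ∧ x[u.length]? = p[0]? := by
  obtain ⟨y, hy, hxy⟩ := exists_typeOne_extension h
  have hl := List.length_pos_iff.2 hp
  have hpy := (List.prefix_append u p).trans hxy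
  obtain ⟨x, hx, hxy'⟩ := exists_edge hu (mem_nodes_of_mem_typeOne hy) hpy (by
    rintro rfl
    have := hxy.length_le
    simp only [List.length_append] at this
    omega)
  refine ⟨x, hx, ?_⟩
  rw [← getElem?_of_prefix hxy' hx.length_lt, getElem?_of_prefix hxy (by simpa using hl)]
  simp [List.getElem?_append_right]

/-! ### Branching degree -/

/-- The symbols by which a string of the trie can be extended come from the symbols of the
text, because p-matching strings have p-matching extensions. -/
theorem exists_finset_of_extensions [Fintype S] [Fintype Q] {u : List (PvSym S)}
    (hu : u ∈ PrevSub T) : ∃ F : Finset (PvSym S), F.card ≤ Fintype.card S + Fintype.card Q ∧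
      ∀ a, u ++ [a] ∈ PrevSub T → a ∈ F := by
  obtain ⟨w, -, rfl⟩ := hu
  refine ⟨Finset.univ.image (encSym w w.length), ?_, fun a ha => ?_⟩
  · exact Finset.card_image_le.trans (by rw [Finset.card_univ, Fintype.card_sum])
  · obtain ⟨w', -, hw'⟩ := ha
    rcases List.eq_nil_or_concat w' with rfl | ⟨z, c, rfl⟩
    · have := congrArg List.length hw'
      simp at this
    rw [List.concat_eq_append, prevEnc_append_singleton] at hw'
    obtain ⟨h1, h2⟩ := List.append_inj' hw' rfl
    obtain ⟨f, hf, rfl⟩ := PMatch.of_prevEnc_eq h1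
    have h3 := prevEnc_map hf (z ++ [c])
    rw [List.map_append, List.map_singleton, prevEnc_append_singleton,
      prevEnc_append_singleton] at h3
    have h4 := (List.append_inj' h3 rfl).2
    rw [h2] at h4
    rw [Finset.mem_image]
    exact ⟨f c, Finset.mem_univ _, by simpa using h4⟩

theorem IsEdge.exists_symbol {u v : List (PvSym S)} (h : IsEdge T u v) :
    ∃ a, v[u.length]? = some a ∧ u ++ [a] ∈ PrevSub T := by
  have hl := h.length_lt
  refine ⟨v[u.length], List.getElem?_eq_getElem hl, ?_⟩
  obtain ⟨s, hs⟩ := h.2.2.1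
  refine mem_prevSub_of_prefix (mem_prevSub_of_mem_nodes h.2.1) ?_
  subst hs
  rcases s with _ | ⟨a, s⟩
  · simp at hl
  · exact ⟨s, by simp⟩

/-! ### Suffix links along an edge -/

theorem IsReSign.unique {u v : List (PvSym S)} (hu : u ≠ []) (hv : v ∈ PrevSub T) {r r' : ℕ}
    (h : IsReSign u v r) (h' : RefersToFirst u v r') : r = r' := by
  have hl := List.length_pos_iff.2 hu
  obtain ⟨w, -, rfl⟩ := hv
  rcases h with h | h
  · have := refersToFirst_unique (by have := h.1; omega) (by have := h'.1; omega) h.2 h'.2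
    have := h.1
    have := h'.1
    omega
  · exact absurd h' (h.2 _)

theorem sl_append {u s : List (PvSym S)} (hu : u ≠ []) (hv : u ++ s ∈ PrevSub T) {r : ℕ}
    (hr : IsReSign u (u ++ s) r) : sl (u ++ s) = sl u ++ relabel r s := by
  have hl := List.length_pos_iff.2 hu
  apply List.ext_getElem?
  intro i
  rw [getElem?_sl, List.getElem?_append, List.getElem?_append, length_sl]
  by_cases hi : i + 1 < u.length
  · rw [if_pos hi, if_pos (by omega), getElem?_sl]
  rw [if_neg hi, if_neg (by omega), getElem?_relabel,
    show i + 1 - u.length = i - (u.length - 1) by omega]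
  obtain ⟨j, rfl⟩ : ∃ j, i = u.length - 1 + j := ⟨i - (u.length - 1), by omega⟩
  rw [show u.length - 1 + j - (u.length - 1) = j by omega,
    show u.length - 1 + j + 1 = u.length + j by omega]
  rcases h : s[j]? with _ | a
  · simp
  have hget : (u ++ s)[u.length + j]? = some a := by
    rw [List.getElem?_append_right (by omega), Nat.add_sub_cancel_left, h]
  rcases a with a | d
  · have : j + 1 ≠ r := by
      rintro rfl
      rcases hr with ⟨-, hr⟩ | hr
      · rw [show u.length + (j + 1) - 1 = u.length + j by omega, hget] at hr
        simp at hr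
      · omega
    simp [this, reSym]
  · have hd := le_of_mem_prevSub hv hget
    have key : j + 1 = r ↔ d = u.length + j := by
      constructor
      · rintro rfl
        rcases hr with ⟨-, hr⟩ | hr
        · rw [show u.length + (j + 1) - 1 = u.length + j by omega, hget] at hr
          simpa using hr
        · omega
      · rintro rfl
        refine (hr.unique hu hv ⟨by omega, ?_⟩).symm
        rw [show u.length + (j + 1) - 1 = u.length + j by omega, hget]
    simp only [Option.map_some, reSym]
    by_cases hc : j + 1 = r
    · rw [if_pos hc, if_pos (by rw [key.1 hc]; push_cast; omega)]
    · rw [if_neg hc, if_neg (by have := fun h => hc (key.2 h); push_cast; omega)]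

/-- What following a fast link from an edge below `u` to the node `w` means for the strings, if
`s` is the relabelled string of that edge. The path from `w` that spells `s` leads to a node without
branching, and it either consists of several edges, or is an edge with positive re-encoding
sign, or is an edge with a bad endpoint. -/
structure FastTarget (T : List (PSym S Q)) (u w s : List (PvSym S)) : Prop where
  node : w ∈ nodes T
  node_append : w ++ s ∈ nodes T
  unbranched : Unbranched T w (w ++ s)
  length_lt : w.length < u.length
  split_or_sign_or_bad : ¬ IsEdge T w (w ++ s) ∨ (∃ r, RefersToFirst w (w ++ s) r) ∨
    ¬ Good T w ∨ ¬ Good T (w ++ s)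

theorem IsFastLink.fastTarget {u s w : List (PvSym S)} {r : ℕ} (he : IsEdge T u (u ++ s))
    (hgu : Good T u) (hgv : Good T (u ++ s)) (hr : IsReSign u (u ++ s) r)
    (h : IsFastLink T u (u ++ s) w) : FastTarget T u w (relabel r s) := by
  obtain ⟨k, hk1, rfl, hfast, hmin⟩ := h
  have hs : 0 < s.length := by
    have := he.length_lt
    rw [List.length_append] at this
    omega
  have hlu := List.length_pos_iff.2 hgu.2.1
  -- As long as the fast link may not stop, the suffix links of the ends form an edge with
  -- re-encoding sign `0`, so that the next suffix link leaves its label unchanged.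
  have key : ∀ j, 1 ≤ j → j ≤ k →
      sl^[j] (u ++ s) = sl^[j] u ++ relabel r s ∧ sl^[j] u ∈ nodes T ∧
      sl^[j] (u ++ s) ∈ nodes T ∧ Unbranched T (sl^[j] u) (sl^[j] (u ++ s)) ∧
      (sl^[j] u).length < u.length := by
    intro j hj
    induction j, hj using Nat.le_induction with
    | base =>
      intro _
      refine ⟨sl_append hgu.2.1 (mem_prevSub_of_mem_nodes he.2.1) hr, hgu.2.2, hgv.2.2,
        he.unbranched_sl hgu.2.1, ?_⟩
      rw [Function.iterate_one, length_sl]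
      omega
    | succ j hj ih =>
      intro hjk
      obtain ⟨h1, h2, h3, h4, h5⟩ := ih (by omega)
      have hns := hmin j hj (by omega)
      rw [Function.iterate_succ_apply', Function.iterate_succ_apply']
      have hpre : sl^[j] u <+: sl^[j] (u ++ s) := h1 ▸ List.prefix_append _ _
      obtain ⟨x, hx, hxy⟩ := exists_edge h2 h3 hpre (fun hc => by
        have := congrArg List.length (hc.trans h1)
        simp only [List.length_append, length_relabel] at this
        omega)
      have hx0 := (getElem?_of_prefix hxy hx.length_lt).symm
      have hxe : x = sl^[j] (u ++ s) := hxy.eq_of_length_le (by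
        by_contra hc
        exact hns ⟨x, hx, hx0, Or.inl (by omega)⟩)
      have hre : ∀ r, 0 < r → ¬ IsReSign (sl^[j] u) x r := fun r hr0 hr =>
        hns ⟨x, hx, hx0, Or.inr (Or.inl ⟨r, hr0, hr⟩)⟩
      have hg1 : Good T (sl^[j] u) := by
        by_contra hc
        exact hns ⟨x, hx, hx0, Or.inr (Or.inr (Or.inl hc))⟩
      have hg2 : Good T x := by
        by_contra hc
        exact hns ⟨x, hx, hx0, Or.inr (Or.inr (Or.inr hc))⟩
      subst hxe
      refine ⟨?_, hg1.2.2, hg2.2.2, hx.unbranched_sl hg1.2.1, ?_⟩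
      · rw [h1] at h3 hre ⊢
        obtain ⟨r', hr'⟩ := exists_isReSign (sl^[j] u) (sl^[j] u ++ relabel r s)
        have h0 := hr'.eq_zero hre
        rw [sl_append hg1.2.1 (mem_prevSub_of_mem_nodes h3) hr', h0]
        simp [relabel]
      · rw [length_sl]
        omega
  obtain ⟨h1, h2, h3, h4, h5⟩ := key k hk1 le_rfl
  rw [h1] at h3 h4
  refine ⟨h2, h3, h4, h5, ?_⟩
  by_cases hedge : IsEdge T (sl^[k] u) (sl^[k] u ++ relabel r s)
  · right
    obtain ⟨x, hx, hx0, hst⟩ := hfast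
    rw [h1] at hx0 hst
    obtain rfl := hx.eq_of_edge hedge hx0
    rcases hst with hst | ⟨r', hr0, hr'⟩ | hst
    · omega
    · rcases hr' with hr' | hr'
      · exact Or.inl ⟨r', hr'⟩
      · omega
    · exact Or.inr hst
  · exact Or.inl hedge

end Trie

/-! ### Positive numbers in a string -/

section Weight

variable {S : Type*}

/-- Whether a symbol is a positive number. -/
def isPositive : PvSym S → Bool
  | Sum.inl _ => false
  | Sum.inr d => decide (0 < d)

/-- The number of positive numbers in a string. Re-encoding one of these symbols
decreases it by one. -/
def weight (p : List (PvSym S)) : ℕ := p.countP isPositive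

theorem weight_append (p q : List (PvSym S)) : weight (p ++ q) = weight p + weight q :=
  List.countP_append

theorem weight_le_length (p : List (PvSym S)) : weight p ≤ p.length := List.countP_le_length

theorem relabel_of_length_lt {r : ℕ} {p : List (PvSym S)} (h : p.length < r) :
    relabel r p = p := by
  rw [relabel, if_neg (by omega), List.set_eq_of_length_le (by omega)]

theorem weight_relabel_add {r : ℕ} {p : List (PvSym S)} (h0 : 0 < r) {d : ℕ} (hd : 0 < d)
    (h : p[r - 1]? = some (Sum.inr d)) : weight (relabel r p) + 1 = weight p := by
  obtain ⟨hl, hp⟩ := List.getElem?_eq_some_iff.1 h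
  have hpos : 0 < weight p :=
    List.countP_pos_iff.2 ⟨_, List.getElem_mem hl, by rw [hp]; simpa [isPositive] using hd⟩
  rw [relabel, if_neg (by omega), weight, List.countP_set hl, hp]
  simp only [isPositive, hd, decide_true, if_true, lt_self_iff_false, decide_false,
    Bool.false_eq_true, if_false]
  unfold weight at hpos ⊢
  omega

theorem weight_relabel_le (r : ℕ) (p : List (PvSym S)) : weight (relabel r p) ≤ weight p := by
  rcases Nat.lt_or_ge p.length r with h | h
  · rw [relabel_of_length_lt h]
  rcases Nat.eq_zero_or_pos r with rfl | h0
  · simp [relabel]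
  · rw [relabel, if_neg (by omega), weight, List.countP_set (by omega)]
    simp [isPositive, weight]

theorem weight_pos {p : List (PvSym S)} {i d : ℕ} (hd : 0 < d)
    (h : p[i]? = some (Sum.inr d)) : 0 < weight p :=
  List.countP_pos_iff.2 ⟨_, List.mem_of_getElem? h, by simpa [isPositive] using hd⟩

theorem prefix_iff_forall_getElem?_eq {α : Type*} {p s : List α} :
    p <+: s ↔ ∀ i < p.length, p[i]? = s[i]? := by
  rw [List.prefix_iff_getElem?]
  constructor
  · intro h i hi
    rw [h i hi, List.getElem?_eq_getElem hi]
  · intro h i hi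
    rw [← h i hi, List.getElem?_eq_getElem hi]

/-- If the position that is re-encoded is checked first, then re-encoding does not affect a
comparison. -/
theorem relabel_prefix_iff {r : ℕ} {p s : List (PvSym S)}
    (hc : 1 ≤ r → r ≤ p.length → p[r - 1]? = s[r - 1]?) :
    relabel r p <+: relabel r s ↔ p <+: s := by
  rw [prefix_iff_forall_getElem?_eq, prefix_iff_forall_getElem?_eq, length_relabel]
  refine forall₂_congr fun i hi => ?_
  rw [getElem?_relabel, getElem?_relabel]
  split_ifs with h
  · subst h
    have := hc (by omega) (by omega)
    rw [Nat.add_sub_cancel] at this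
    simp [this]
  · rfl

theorem RefersToFirst.getElem?_label {u s : List (PvSym S)} {r : ℕ}
    (h : RefersToFirst u (u ++ s) r) : s[r - 1]? = some (Sum.inr (u.length + r - 1)) := by
  obtain ⟨h1, h2⟩ := h
  rwa [List.getElem?_append_right (by omega),
    show u.length + r - 1 - u.length = r - 1 by omega] at h2

end Weight

/-! ### Splitting a pattern at the end of an edge -/

section Split

variable {S Q : Type*} [DecidableEq S] [DecidableEq Q] {T : List (PSym S Q)}

/-- The string `p` is `p₁ ++ p₂`, where `p₁` is to be compared with the string `s` of the
edge that starts with the first symbol of `p`. -/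
structure EdgeSplit (T : List (PSym S Q)) (u s p₁ p₂ : List (PvSym S)) : Prop where
  edge : IsEdge T u (u ++ s)
  length_pos : 0 < p₁.length
  first : p₁[0]? = s[0]?
  length_le : p₁.length ≤ s.length
  length_eq : p₂ ≠ [] → p₁.length = s.length

variable {u s p₁ p₂ : List (PvSym S)}

theorem EdgeSplit.mem_iff (h : EdgeSplit T u s p₁ p₂) :
    u ++ (p₁ ++ p₂) ∈ PrevSub T ↔ p₁ <+: s ∧ (u ++ s) ++ p₂ ∈ PrevSub T := by
  have hs := mem_prevSub_of_mem_nodes h.edge.2.1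
  have h1 := h.edge.unbranched.append_mem_iff hs h.first h.length_le
  rcases eq_or_ne p₂ [] with rfl | h2
  · simp [h1, hs]
  · constructor
    · intro hm
      have hp : p₁ <+: s := h1.1 (mem_prevSub_of_prefix hm ⟨p₂, by simp⟩)
      have he := hp.eq_of_length (h.length_eq h2)
      exact ⟨hp, by rwa [← he, List.append_assoc]⟩
    · rintro ⟨hp, hm⟩
      have he := hp.eq_of_length (h.length_eq h2)
      rwa [← List.append_assoc, he]

/-- A node below an edge lies below the lower end of this edge. -/
theorem EdgeSplit.eq_of_mem_nodes (h : EdgeSplit T u s p₁ p₂) (hn : u ++ (p₁ ++ p₂) ∈ nodes T) :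
    p₁ = s := by
  have hpos := h.length_pos
  have hp := h.edge.prefix_of_node hn (List.prefix_append _ _) (fun he => by
    have := congrArg List.length he
    simp only [List.length_append] at this
    omega) (by simp [List.getElem?_append_right, ← h.first, List.getElem?_append_left hpos])
  rw [List.prefix_append_right_inj] at hp
  rcases eq_or_ne p₂ [] with rfl | h2
  · rw [List.append_nil] at hp
    exact (hp.eq_of_length_le h.length_le).symm
  · exact (List.prefix_of_prefix_length_le (List.prefix_append p₁ p₂) hp h.length_le).eq_of_length
      (h.length_eq h2)

theorem EdgeSplit.eq_nil_of_isEdge (h : EdgeSplit T u s p₁ p₂)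
    (he : IsEdge T u (u ++ (p₁ ++ p₂))) : p₂ = [] := by
  obtain rfl := h.eq_of_mem_nodes he.2.1
  have := h.length_pos
  rcases he.2.2.2.2 _ h.edge.2.1 (List.prefix_append _ _) ⟨p₂, by simp⟩ with h1 | h1 <;>
  · have := congrArg List.length h1
    simp only [List.length_append] at this
    first
    | omega
    | exact List.eq_nil_of_length_eq_zero (by omega)

end Split

/-! ### Results and costs of calls -/

section Outcome

variable {S Q ν : Type*} [DecidableEq S] [DecidableEq Q] {T : List (PSym S Q)}
  {str : ν → List (PvSym S)} {D : Data S ν}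

/-- What is claimed about a call `P-Match(p, u)` that takes `t` steps, follows `h` fast links
and returns `r`, if no node has more than `K` children. The string `p` is arbitrary: the
calls through fast links are made before it is known whether `p` occurs below `u`.

The bound `hops_le` holds in general, since each fast link leads to a node of smaller depth. The
bounds for a string that ends at a node do not depend on the depth. They improve if `p` spells
several edges, or an edge with positive re-encoding sign or with a bad endpoint, which is what
happens after a fast link. -/
structure Outcome (T : List (PSym S Q)) (str : ν → List (PvSym S)) (K : ℕ) (u : ν)
    (p : List (PvSym S)) (t h : ℕ) (r : Option ν) : Prop where
  isSome_iff : r.isSome ↔ str u ++ p ∈ PrevSub T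
  eq_some : ∀ v, str v = str u ++ p → r = some v
  time_le : t ≤ (K + 5) * h + (K + 6) * p.length + 1
  hops_le : h ≤ 2 * p.length + weight p + (str u).length
  hops_nil : p = [] → h = 0
  hops_node : p ≠ [] → str u ++ p ∈ nodes T → h + 1 ≤ p.length + weight p
  hops_improved : p ≠ [] → str u ++ p ∈ nodes T →
    (¬ IsEdge T (str u) (str u ++ p) ∨
      (str u ≠ [] ∧ ∃ r, RefersToFirst (str u) (str u ++ p) r)) →
    h + 2 ≤ p.length + weight p
  hops_bad : p ≠ [] → IsEdge T (str u) (str u ++ p) →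
    (¬ Good T (str u) ∨ ¬ Good T (str u ++ p)) → h = 0

variable {K : ℕ} {u : ν} {p : List (PvSym S)} {t h : ℕ}

theorem Represents.mem_nodes (hD : Represents T D str) (u : ν) : str u ∈ nodes T :=
  hD.range_str ▸ Set.mem_range_self u

theorem Outcome.nil (hD : Represents T D str) (K : ℕ) (u : ν) :
    Outcome T str K u [] 1 0 (some u) where
  isSome_iff := by simp [mem_prevSub_of_mem_nodes (hD.mem_nodes u)]
  eq_some v hv := by rw [hD.str_injective (hv.trans (List.append_nil _))]
  time_le := by simp
  hops_le := by simp
  hops_nil _ := rfl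
  hops_node h := absurd rfl h
  hops_improved h := absurd rfl h
  hops_bad h := absurd rfl h

theorem Outcome.none (hD : Represents T D str) (hp : p ≠ []) (hm : str u ++ p ∉ PrevSub T)
    (ht : t ≤ (K + 5) * h + (K + 6) * p.length + 1)
    (hh : h ≤ 2 * p.length + weight p + (str u).length) : Outcome T str K u p t h none where
  isSome_iff := by simp [hm]
  eq_some v hv := absurd (hv ▸ mem_prevSub_of_mem_nodes (hD.mem_nodes v)) hm
  time_le := ht
  hops_le := hh
  hops_nil h := absurd h hp
  hops_node _ h := absurd (mem_prevSub_of_mem_nodes h) hm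
  hops_improved _ h := absurd (mem_prevSub_of_mem_nodes h) hm
  hops_bad _ h := absurd (mem_prevSub_of_mem_nodes h.2.1) hm

variable {v : ν} {s p₁ p₂ : List (PvSym S)} {t₂ : ℕ} {r : Option ν}

/-- A call that matches an edge without a fast link. -/
theorem Outcome.of_edge (hD : Represents T D str) (hv : str v = str u ++ s)
    (hs : EdgeSplit T (str u) s p₁ p₂) (hm : p₁ <+: s) (o₂ : Outcome T str K v p₂ t₂ h r)
    (ht : t ≤ K + 5 + p₁.length + t₂) : Outcome T str K u (p₁ ++ p₂) t h r := by
  have hpos := hs.length_pos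
  have heq := o₂.hops_nil
  have hmem := hs.mem_iff
  rw [← hv] at hmem
  refine ⟨?_, fun v' hv' => ?_, ?_, ?_, fun h0 => ?_, fun _ hn => ?_, fun _ hn hst => ?_,
    fun _ he hb => ?_⟩
  · rw [hmem, o₂.isSome_iff]
    simp [hm]
  · have := hs.eq_of_mem_nodes (hv' ▸ hD.mem_nodes v')
    apply o₂.eq_some
    rw [hv', hv, this, List.append_assoc]
  · have := o₂.time_le
    rw [List.length_append]
    nlinarith
  · have := o₂.hops_le
    rw [hv] at this
    simp only [List.length_append, weight_append] at this ⊢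
    by_cases h2 : p₂ = []
    · have := heq h2
      omega
    · have := hs.length_eq h2
      omega
  · exact heq (List.append_eq_nil_iff.1 h0).2
  · simp only [List.length_append, weight_append]
    by_cases h2 : p₂ = []
    · have := heq h2
      omega
    · have := o₂.hops_node h2 (by
        rwa [hv, List.append_assoc, ← hs.eq_of_mem_nodes hn])
      omega
  · simp only [List.length_append, weight_append]
    by_cases h2 : p₂ = []
    · have := heq h2
      subst h2
      rw [List.append_nil] at hst hn
      rcases hst with hst | ⟨hne, q, hq⟩
      · rw [hs.eq_of_mem_nodes (by simpa using hn)] at hst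
        exact absurd hs.edge hst
      · have hne' := List.length_pos_iff.2 hne
        have := weight_pos (by have := hq.1; omega) hq.getElem?_label
        omega
    · have := o₂.hops_node h2 (by
        rwa [hv, List.append_assoc, ← hs.eq_of_mem_nodes hn])
      omega
  · exact heq (hs.eq_nil_of_isEdge he)

variable {w : ν} {t₁ h₁ h₂ n : ℕ} {r₁ : Option ν}

/-- A call that matches an edge through a fast link. -/
theorem Outcome.of_fastLink (hD : Represents T D str) (hv : str v = str u ++ s)
    (hs : EdgeSplit T (str u) s p₁ p₂) (hs2 : 2 ≤ s.length)
    (hgu : Good T (str u)) (hgv : Good T (str v))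
    (hn : IsReSign (str u) (str v) n) (hf : FastTarget T (str u) (str w) (relabel n s))
    (hm : p₁ <+: s) (o₁ : Outcome T str K w (relabel n p₁) t₁ h₁ r₁)
    (o₂ : Outcome T str K v p₂ t₂ h₂ r)
    (ht : t ≤ K + 4 + t₁ + t₂) : Outcome T str K u (p₁ ++ p₂) t (h₁ + h₂ + 1) r := by
  have hpos := hs.length_pos
  have heq := o₂.hops_nil
  have hmem := hs.mem_iff
  rw [← hv] at hmem
  have hlu := List.length_pos_iff.2 hgu.2.1
  have hsign : 0 < n → weight (relabel n s) + 1 = weight s := by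
    intro h0
    rcases hn with hn | hn
    · rw [hv] at hn
      exact weight_relabel_add h0 (by omega) hn.getElem?_label
    · omega
  have hwle := weight_relabel_le n s
  -- The fast link of a completely matched edge leads to a path for which a better bound holds.
  have hh1 : p₁ = s → h₁ + 2 ≤ s.length + weight (relabel n s) := by
    rintro rfl
    have hne : relabel n p₁ ≠ [] := by
      rw [← List.length_pos_iff]
      simpa using hpos
    by_cases hbad : IsEdge T (str w) (str w ++ relabel n p₁) ∧
        (¬ Good T (str w) ∨ ¬ Good T (str w ++ relabel n p₁))
    · have := o₁.hops_bad hne hbad.1 hbad.2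
      omega
    · have := o₁.hops_improved hne hf.node_append (by
        rcases hf.split_or_sign_or_bad with h | h | h
        · exact Or.inl h
        · by_cases he : IsEdge T (str w) (str w ++ relabel n p₁)
          · refine Or.inr ⟨fun h0 => hbad ⟨he, Or.inl fun hg => hg.2.1 h0⟩, h⟩
          · exact Or.inl he
        · by_cases he : IsEdge T (str w) (str w ++ relabel n p₁)
          · exact absurd ⟨he, h⟩ hbad
          · exact Or.inl he)
      rwa [length_relabel] at this
  have hfull : p₂ ≠ [] → p₁ = s := fun h2 => hm.eq_of_length (hs.length_eq h2)
  refine ⟨?_, fun v' hv' => ?_, ?_, ?_, fun h0 => ?_, fun _ hnode => ?_, fun _ hnode hst => ?_,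
    fun _ he hb => ?_⟩
  · rw [hmem, o₂.isSome_iff]
    simp [hm]
  · have := hs.eq_of_mem_nodes (hv' ▸ hD.mem_nodes v')
    apply o₂.eq_some
    rw [hv', hv, this, List.append_assoc]
  · have h1 := o₁.time_le
    have h2 := o₂.time_le
    rw [length_relabel] at h1
    rw [List.length_append]
    nlinarith
  · have h1 := o₁.hops_le
    have h2 := o₂.hops_le
    have hw := weight_relabel_le n p₁
    have hl := hf.length_lt
    rw [hv] at h2
    simp only [List.length_append, weight_append, length_relabel] at h1 h2 ⊢
    by_cases h0 : p₂ = []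
    · have := heq h0
      omega
    · have he := hfull h0
      have := hh1 he
      subst he
      omega
  · have := (List.append_eq_nil_iff.1 h0).1
    simp [this] at hpos
  · obtain rfl := hs.eq_of_mem_nodes hnode
    have := hh1 rfl
    simp only [List.length_append, weight_append]
    by_cases h2 : p₂ = []
    · have := heq h2
      omega
    · have := o₂.hops_node h2 (by rwa [hv, List.append_assoc])
      omega
  · obtain rfl := hs.eq_of_mem_nodes hnode
    have := hh1 rfl
    simp only [List.length_append, weight_append]
    by_cases h2 : p₂ = []
    · have := heq h2
      subst h2
      rw [List.append_nil] at hst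
      rcases hst with hst | ⟨-, q, hq⟩
      · exact absurd hs.edge hst
      · have h0 : 0 < n := by
          rw [(hv ▸ hn : IsReSign _ _ n).unique hgu.2.1
            (mem_prevSub_of_mem_nodes hs.edge.2.1) hq]
          exact hq.1
        have := hsign h0
        omega
    · have := o₂.hops_node h2 (by rwa [hv, List.append_assoc])
      omega
  · obtain rfl := hs.eq_nil_of_isEdge he
    rw [List.append_nil] at hb he
    rw [hs.eq_of_mem_nodes (by simpa using he.2.1), ← hv] at hb
    exact absurd hb (by simp [hgu, hgv])

end Outcome

/-! ### Subwords of the array -/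

section Seg

variable {S : Type*}

/-- The subword `[s, e)` of an array. -/
def seg (arr : ℕ → PvSym S) (s e : ℕ) : List (PvSym S) :=
  (List.range (e - s)).map fun i => arr (s + i)

@[simp]
theorem length_seg (arr : ℕ → PvSym S) (s e : ℕ) : (seg arr s e).length = e - s := by
  simp [seg]

theorem getElem?_seg (arr : ℕ → PvSym S) (s e i : ℕ) :
    (seg arr s e)[i]? = if i < e - s then some (arr (s + i)) else none := by
  rw [seg, List.getElem?_map]
  split_ifs with h
  · rw [List.getElem?_range h, Option.map_some]
  · rw [List.getElem?_eq_none (by simpa using h), Option.map_none]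

theorem seg_append (arr : ℕ → PvSym S) {s t e : ℕ} (h1 : s ≤ t) (h2 : t ≤ e) :
    seg arr s t ++ seg arr t e = seg arr s e := by
  apply List.ext_getElem?
  intro i
  rw [List.getElem?_append, length_seg, getElem?_seg, getElem?_seg, getElem?_seg]
  split_ifs <;> first | rfl | omega | (congr 2; omega)

theorem seg_congr {arr arr' : ℕ → PvSym S} {s e : ℕ} (h : ∀ i, s ≤ i → i < e → arr i = arr' i) :
    seg arr s e = seg arr' s e := by
  apply List.ext_getElem?
  intro i
  rw [getElem?_seg, getElem?_seg]
  split_ifs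
  · rw [h _ (by omega) (by omega)]
  · rfl

theorem seg_update (arr : ℕ → PvSym S) {s e r : ℕ} (h0 : 1 ≤ r) :
    seg (Function.update arr (s + r - 1) (Sum.inr 0)) s e = relabel r (seg arr s e) := by
  apply List.ext_getElem?
  intro i
  rw [getElem?_relabel, getElem?_seg, getElem?_seg]
  split_ifs with h1 h2 h2
  · rw [show s + i = s + r - 1 by omega, Function.update_self]
    rfl
  · rw [Function.update_of_ne (by omega)]
  · rfl
  · rfl

theorem seg_self (arr : ℕ → PvSym S) (s : ℕ) : seg arr s s = [] := by
  simp [seg]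

theorem seg_getD (p : List (PvSym S)) (a : PvSym S) :
    seg (fun i => p.getD i a) 0 p.length = p := by
  apply List.ext_getElem?
  intro i
  rw [getElem?_seg]
  split_ifs with h
  · simp [List.getD, List.getElem?_eq_getElem (show i < p.length by omega)]
  · exact (List.getElem?_eq_none (by omega)).symm

end Seg

/-! ### Runs of the machine -/

section Run

variable {S Q ν : Type*} [DecidableEq S] [DecidableEq Q] {T : List (PSym S Q)}
  {str : ν → List (PvSym S)} {D : Data S ν} {P : List (PSym S Q)}

theorem Represents.isEdge (hD : Represents T D str) {u : ν} {g : Edge S ν}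
    (hg : g ∈ D.children u) : IsEdge T (str u) (str g.target) :=
  (hD.children_iff u g.target).1 (List.mem_map_of_mem hg)

/-- A reference into the stored text gives the string of the edge symbol by symbol. -/
theorem Represents.textSym_eq (hD : Represents T D str) {u : ν} {g : Edge S ν}
    (hg : g ∈ D.children u) {i j : ℕ} {k : ℤ} (hl : g.label = Label.ref i j k) {q : ℕ}
    (hq : q < (str g.target).length - (str u).length) :
    (str g.target)[(str u).length + q]? = some (D.textSym (i + q) k) := by
  obtain ⟨-, hi, hj, he⟩ := hD.label_ref u g hg i j k hl
  have h1 := congrArg (fun l => l[q]?) he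
  simp only [List.getElem?_drop] at h1
  rw [← h1]
  have h2 : (((reencode k D.text).take j).drop (i - 1))[q]? ≠ none := by
    rw [he, List.getElem?_drop]
    simp only [ne_eq, List.getElem?_eq_none_iff]
    omega
  rw [List.getElem?_drop, List.getElem?_take] at h2
  rw [List.getElem?_take]
  split_ifs at h2 ⊢ with h3
  · have h4 : i - 1 + q < D.text.length := by omega
    rw [reencode, List.getElem?_mapIdx, List.getElem?_eq_getElem h4, Option.map_some,
      Data.textSym, List.getD_eq_getElem?_getD, show i + q - 1 = i - 1 + q by omega,
      List.getElem?_eq_getElem h4, show i - 1 + q + 1 = i + q by omega]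
    rfl
  · exact absurd rfl h2

theorem Represents.firstSym_eq (hD : Represents T D str) {u : ν} {g : Edge S ν}
    (hg : g ∈ D.children u) : (str g.target)[(str u).length]? = some (D.firstSym g) := by
  have hlt := (hD.isEdge hg).length_lt
  unfold Data.firstSym
  rcases hl : g.label with a | ⟨i, j, k⟩
  · exact (hD.label_sym u g hg a hl).2
  · exact hD.textSym_eq hg hl (q := 0) (by omega)

theorem Represents.length_children_le [Fintype S] [Fintype Q] (hD : Represents T D str) (u : ν) :
    (D.children u).length ≤ Fintype.card S + Fintype.card Q := by
  classical
  obtain ⟨F, hF, hmem⟩ := exists_finset_of_extensions (mem_prevSub_of_mem_nodes (hD.mem_nodes u))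
  have hnd : ((D.children u).map D.firstSym).Nodup := by
    refine List.Nodup.map_on (fun g hg g' hg' he => ?_) (hD.children_nodup u).of_map
    have h1 := (hD.isEdge hg).eq_of_edge (hD.isEdge hg')
      (by rw [hD.firstSym_eq hg, hD.firstSym_eq hg', he])
    exact List.inj_on_of_nodup_map (hD.children_nodup u) hg hg' (hD.str_injective h1)
  rw [← List.length_map D.firstSym, ← List.toFinset_card_of_nodup hnd]
  refine (Finset.card_le_card fun a ha => ?_).trans hF
  rw [List.mem_toFinset, List.mem_map] at ha
  obtain ⟨g, hg, rfl⟩ := ha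
  obtain ⟨a, ha, hm⟩ := (hD.isEdge hg).exists_symbol
  rw [hD.firstSym_eq hg, Option.some.injEq] at ha
  exact hmem _ (ha ▸ hm)

theorem Represents.good_iff (hD : Represents T D str) (u : ν) :
    Good T (str u) ↔ (D.slink u).isSome := by
  rw [Option.isSome_iff_exists]
  constructor
  · rintro ⟨-, h1, h2⟩
    rw [← hD.range_str] at h2
    obtain ⟨w, hw⟩ := h2
    exact ⟨w, (hD.slink_eq u w).2 ⟨h1, hw⟩⟩
  · rintro ⟨w, hw⟩
    obtain ⟨h1, h2⟩ := (hD.slink_eq u w).1 hw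
    exact ⟨hD.mem_nodes u, h1, h2 ▸ hD.mem_nodes w⟩

theorem iterate_step_add (D : Data S ν) (P : List (PSym S Q)) {m n : ℕ}
    {c c' c'' : Config S Q ν} (h1 : (step D P)^[m] c = c') (h2 : (step D P)^[n] c' = c'') :
    (step D P)^[m + n] c = c'' := by
  rw [Nat.add_comm, Function.iterate_add_apply, h1, h2]

theorem exists_scan (D : Data S ν) (P : List (PSym S Q)) (s e : ℕ) (u : ν)
    (arr : ℕ → PvSym S) (st : List (ℕ × ℕ × ν)) (n : ℕ) (rest : List (Edge S ν)) :
    ∃ t ≤ rest.length + 1,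
      (∃ g ∈ rest, D.firstSym g = arr s ∧
        (step D P)^[t] ⟨Ctl.scan s e u rest, arr, st, n⟩ = ⟨Ctl.edge s e u g, arr, st, n⟩) ∨
      (∀ g ∈ rest, D.firstSym g ≠ arr s) ∧
        (step D P)^[t] ⟨Ctl.scan s e u rest, arr, st, n⟩ = ⟨Ctl.ret none, arr, st, n⟩ := by
  induction rest with
  | nil => exact ⟨1, le_rfl, Or.inr ⟨by simp, rfl⟩⟩
  | cons g rest ih =>
    by_cases h : D.firstSym g = arr s
    · exact ⟨1, by omega, Or.inl ⟨g, by simp, h, by simp [step, h]⟩⟩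
    · have h1 : (step D P)^[1] ⟨Ctl.scan s e u (g :: rest), arr, st, n⟩ =
          ⟨Ctl.scan s e u rest, arr, st, n⟩ := by simp [step, h]
      obtain ⟨t, ht, ⟨g', hg', hf, hr⟩ | ⟨hf, hr⟩⟩ := ih
      · exact ⟨1 + t, by rw [List.length_cons]; omega,
          Or.inl ⟨g', List.mem_cons_of_mem _ hg', hf, iterate_step_add D P h1 hr⟩⟩
      · refine ⟨1 + t, by rw [List.length_cons]; omega,
          Or.inr ⟨?_, iterate_step_add D P h1 hr⟩⟩
        intro g' hg'
        rcases List.mem_cons.1 hg' with rfl | hg'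
        · exact h
        · exact hf g' hg'

theorem exists_cmp (D : Data S ν) (P : List (PSym S Q)) (t e : ℕ) (v : ν) (k : ℤ)
    (arr : ℕ → PvSym S) (st : List (ℕ × ℕ × ν)) (n : ℕ) (l : ℕ) :
    ∀ s i, s + l = t → ∃ q ≤ l + 1,
      ((∀ j < l, arr (s + j) = D.textSym (i + j) k) ∧
        (step D P)^[q] ⟨Ctl.cmp s t e v i k, arr, st, n⟩ = ⟨Ctl.call t e v, arr, st, n⟩) ∨
      (¬ (∀ j < l, arr (s + j) = D.textSym (i + j) k) ∧
        (step D P)^[q] ⟨Ctl.cmp s t e v i k, arr, st, n⟩ = ⟨Ctl.ret none, arr, st, n⟩) := by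
  induction l with
  | zero =>
    rintro s i rfl
    exact ⟨1, le_rfl, Or.inl ⟨by simp, by simp [step]⟩⟩
  | succ l ih =>
    intro s i hst
    have hne : s ≠ t := by omega
    by_cases h : arr s = D.textSym i k
    · have h1 : (step D P)^[1] ⟨Ctl.cmp s t e v i k, arr, st, n⟩ =
          ⟨Ctl.cmp (s + 1) t e v (i + 1) k, arr, st, n⟩ := by simp [step, h, hne]
      have hiff : (∀ j < l + 1, arr (s + j) = D.textSym (i + j) k) ↔
          ∀ j < l, arr (s + 1 + j) = D.textSym (i + 1 + j) k := by
        constructor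
        · intro hj j hl
          have := hj (j + 1) (by omega)
          rwa [show s + 1 + j = s + (j + 1) by omega, show i + 1 + j = i + (j + 1) by omega]
        · intro hj j hl
          rcases j with _ | j
          · exact h
          · have := hj j (by omega)
            rwa [show s + 1 + j = s + (j + 1) by omega,
              show i + 1 + j = i + (j + 1) by omega] at this
      rw [hiff]
      obtain ⟨q, hq, hr⟩ := ih (s + 1) (i + 1) (by omega)
      refine ⟨1 + q, by omega, ?_⟩
      rcases hr with ⟨hf, hr⟩ | ⟨hf, hr⟩
      · exact Or.inl ⟨hf, iterate_step_add D P h1 hr⟩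
      · exact Or.inr ⟨hf, iterate_step_add D P h1 hr⟩
    · exact ⟨1, by omega, Or.inr ⟨fun hj => h (hj 0 (by omega)), by simp [step, h, hne]⟩⟩

/-- What happens to the part `p[s, s + l)` of the pattern at an edge `g` from `u` before the
next call: it is found to differ from the string of the edge, or it is found to agree with it,
or the comparison is passed on to the fast link. -/
theorem exists_edge_run (hD : Represents T D str) (P : List (PSym S Q)) {s e : ℕ} {u : ν}
    {g : Edge S ν} (hg : g ∈ D.children u) {arr : ℕ → PvSym S} (st : List (ℕ × ℕ × ν)) (n : ℕ)
    (hse : s < e) (hf : D.firstSym g = arr s) {lab : List (PvSym S)}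
    (hlab : str g.target = str u ++ lab) {l : ℕ} (hl : l = min (e - s) lab.length) :
    (∃ t ≤ l + 2, ¬ seg arr s (s + l) <+: lab ∧
      (step D P)^[t] ⟨Ctl.edge s e u g, arr, st, n⟩ = ⟨Ctl.ret none, arr, st, n⟩) ∨
    (∃ t ≤ l + 2, seg arr s (s + l) <+: lab ∧
      (step D P)^[t] ⟨Ctl.edge s e u g, arr, st, n⟩ =
        ⟨Ctl.call (s + l) e g.target, arr, st, n⟩) ∨
    (2 ≤ l ∧ Good T (str u) ∧ Good T (str g.target) ∧ ∃ w r arr',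
      IsReSign (str u) (str g.target) r ∧
      FastTarget T (str u) (str w) (relabel r lab) ∧
      (∀ i, i < s ∨ s + l ≤ i → arr' i = arr i) ∧
      seg arr' s (s + l) = relabel r (seg arr s (s + l)) ∧
      (relabel r (seg arr s (s + l)) <+: relabel r lab ↔ seg arr s (s + l) <+: lab) ∧
      step D P ⟨Ctl.edge s e u g, arr, st, n⟩ =
        ⟨Ctl.call s (s + l) w, arr', (s + l, e, g.target) :: st, n + 1⟩) := by
  have hedge := hD.isEdge hg
  have hlt := hedge.length_lt
  have hfirst := hD.firstSym_eq hg
  have hlen : D.depth g.target - D.depth u = lab.length := by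
    rw [hD.depth_eq, hD.depth_eq, hlab, List.length_append]
    omega
  rw [hlab, List.getElem?_append_right le_rfl, Nat.sub_self] at hfirst
  rw [hlab, List.length_append] at hlt
  have hstep : step D P ⟨Ctl.edge s e u g, arr, st, n⟩ =
      edgeStep D s e u g ⟨Ctl.edge s e u g, arr, st, n⟩ := rfl
  unfold edgeStep at hstep
  simp only [hlen, ← hl] at hstep
  by_cases hl2 : l < 2
  · rw [if_pos hl2] at hstep
    refine Or.inr (Or.inl ⟨1, by omega, ?_, hstep⟩)
    rw [prefix_iff_forall_getElem?_eq]
    intro i hi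
    rw [length_seg] at hi
    obtain rfl : i = 0 := by omega
    rw [getElem?_seg, if_pos hi, hfirst, hf, Nat.add_zero]
  rw [if_neg hl2] at hstep
  by_cases hgood : Good T (str u) ∧ Good T (str g.target)
  · have h1 := (hD.good_iff _).1 hgood.1
    have h2 := (hD.good_iff _).1 hgood.2
    rw [if_neg (by simp [← Option.not_isSome, h1, h2])] at hstep
    obtain ⟨w, hw, hfast⟩ := hD.fast_link u g hg hgood.1 hgood.2 (by
      rw [hlab, List.length_append]
      omega)
    have hre := hD.re_sign _ _ hedge
    have htgt := IsFastLink.fastTarget (hlab ▸ hedge) hgood.1 (hlab ▸ hgood.2) (hlab ▸ hre)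
      (hlab ▸ hfast)
    have hsym : 1 ≤ D.re g.target →
        lab[D.re g.target - 1]? = some (Sum.inr (D.depth u + D.re g.target - 1)) := by
      intro h0
      rcases hre with hre | hre
      · rw [hlab] at hre
        rw [hD.depth_eq]
        exact hre.getElem?_label
      · omega
    have hrl : 1 ≤ D.re g.target → D.re g.target ≤ lab.length := by
      intro h0
      obtain ⟨h, -⟩ := List.getElem?_eq_some_iff.1 (hsym h0)
      omega
    simp only [follow, hw] at hstep
    by_cases hr : 1 ≤ D.re g.target ∧ D.re g.target ≤ e - s
    · rw [if_pos hr] at hstep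
      have hr' := hrl hr.1
      have hsg : (seg arr s (s + l))[D.re g.target - 1]? = some (arr (s + D.re g.target - 1)) := by
        rw [getElem?_seg, if_pos (by omega)]
        congr 2
        omega
      by_cases hc : arr (s + D.re g.target - 1) = Sum.inr (D.depth u + D.re g.target - 1)
      · rw [if_pos hc] at hstep
        refine Or.inr (Or.inr ⟨by omega, hgood.1, hgood.2, w, D.re g.target, _, hre, htgt,
          fun i hi => ?_, ?_, ?_, hstep⟩)
        · exact Function.update_of_ne (by omega) _ _
        · exact seg_update arr hr.1
        · refine relabel_prefix_iff fun _ _ => ?_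
          rw [hsg, hsym hr.1, hc]
      · rw [if_neg hc] at hstep
        refine Or.inl ⟨1, by omega, fun hp => hc ?_, hstep⟩
        have := prefix_iff_forall_getElem?_eq.1 hp (D.re g.target - 1)
          (by rw [length_seg]; omega)
        rw [hsg, hsym hr.1] at this
        exact Option.some.inj this
    · rw [if_neg hr] at hstep
      have hrel : relabel (D.re g.target) (seg arr s (s + l)) = seg arr s (s + l) := by
        rcases Nat.eq_zero_or_pos (D.re g.target) with h0 | h0
        · simp [relabel, h0]
        · exact relabel_of_length_lt (by rw [length_seg]; omega)
      refine Or.inr (Or.inr ⟨by omega, hgood.1, hgood.2, w, D.re g.target, arr, hre, htgt,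
        fun i hi => rfl, hrel.symm, relabel_prefix_iff fun h1 h2 => ?_, hstep⟩)
      rw [length_seg] at h2
      omega
  · have hbad : ((D.slink u).isNone || (D.slink g.target).isNone) = true := by
      rw [hD.good_iff, hD.good_iff] at hgood
      revert hgood
      cases D.slink u <;> cases D.slink g.target <;> simp
    rw [if_pos hbad] at hstep
    rcases hlb : g.label with a | ⟨i, j, k⟩
    · rcases (hD.label_sym u g hg a hlb).1 with h | h
      · exact absurd h hgood
      · rw [hlab, List.length_append] at h
        omega
    · simp only [hlb] at hstep
      have hiff : seg arr s (s + l) <+: lab ↔ ∀ j < l, arr (s + j) = D.textSym (i + j) k := by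
        rw [prefix_iff_forall_getElem?_eq, length_seg, Nat.add_sub_cancel_left]
        refine forall₂_congr fun q hq => ?_
        have := hD.textSym_eq hg hlb (q := q) (by rw [hlab, List.length_append]; omega)
        rw [hlab, List.getElem?_append_right (by omega), Nat.add_sub_cancel_left] at this
        rw [this, getElem?_seg, if_pos (by omega), Option.some.injEq]
      rw [hiff]
      obtain ⟨q, hq, hr⟩ := exists_cmp D P (s + l) e g.target k arr st n l s i rfl
      rcases hr with ⟨hm, hr⟩ | ⟨hm, hr⟩
      · exact Or.inr (Or.inl ⟨1 + q, by omega, hm, iterate_step_add D P hstep hr⟩)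
      · exact Or.inl ⟨1 + q, by omega, hm, iterate_step_add D P hstep hr⟩

/-- A call of `P-Match` on a subword of the array returns with the claimed result within the
claimed number of steps. The part of the array outside the subword does not change. -/
theorem exists_outcome (hD : Represents T D str) (P : List (PSym S Q)) {K : ℕ}
    (hK : ∀ u, (D.children u).length ≤ K) (L d : ℕ) :
    ∀ (s e : ℕ) (u : ν) (arr : ℕ → PvSym S) (st : List (ℕ × ℕ × ν)) (n : ℕ), s ≤ e →
      e - s = L → (str u).length = d →
      ∃ t h r arr', Outcome T str K u (seg arr s e) t h r ∧
        (∀ i, i < s ∨ e ≤ i → arr' i = arr i) ∧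
        (step D P)^[t] ⟨Ctl.call s e u, arr, st, n⟩ = ⟨Ctl.ret r, arr', st, n + h⟩ := by
  induction L using Nat.strong_induction_on generalizing d with
  | _ L ihL =>
  induction d using Nat.strong_induction_on with
  | _ d ihd =>
  intro s e u arr st n hse hL hd
  rcases Nat.eq_or_lt_of_le hse with rfl | hlt
  · refine ⟨1, 0, some u, arr, ?_, fun _ _ => rfl, by simp [step]⟩
    rw [seg_self]
    exact Outcome.nil hD K u
  have hp : seg arr s e ≠ [] := by
    rw [← List.length_pos_iff, length_seg]
    omega
  have hp0 : (seg arr s e)[0]? = some (arr s) := by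
    rw [getElem?_seg, if_pos (by omega), Nat.add_zero]
  have hcall : (step D P)^[1] ⟨Ctl.call s e u, arr, st, n⟩ =
      ⟨Ctl.scan s e u (D.children u), arr, st, n⟩ := by simp [step, hlt.ne]
  have hKu := hK u
  obtain ⟨t₀, ht₀, ⟨g, hg, hf, hscan⟩ | ⟨hf, hscan⟩⟩ :=
    exists_scan D P s e u arr st n (D.children u)
  swap
  · -- No edge starts with the first symbol of the pattern.
    refine ⟨1 + t₀, 0, none, arr, Outcome.none hD hp (fun hm => ?_) ?_ (Nat.zero_le _),
      fun _ _ => rfl, iterate_step_add D P hcall hscan⟩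
    · obtain ⟨x, hx, hx0⟩ := exists_edge_of_append_mem (hD.mem_nodes u) hp hm
      obtain ⟨v, rfl⟩ : x ∈ Set.range str := hD.range_str ▸ hx.2.1
      obtain ⟨g, hg, rfl⟩ := List.mem_map.1 ((hD.children_iff u v).2 hx)
      rw [hD.firstSym_eq hg, hp0, Option.some.injEq] at hx0
      exact hf g hg hx0
    · rw [length_seg]
      nlinarith [show 1 ≤ e - s by omega]
  have hpre := iterate_step_add D P hcall hscan
  have hedge := hD.isEdge hg
  obtain ⟨lab, hlab⟩ := hedge.2.2.1
  replace hlab := hlab.symm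
  have hlabpos : 0 < lab.length := by
    have := hedge.length_lt
    rw [hlab, List.length_append] at this
    omega
  obtain ⟨l, hl⟩ : ∃ l, l = min (e - s) lab.length := ⟨_, rfl⟩
  have hsplit : seg arr s (s + l) ++ seg arr (s + l) e = seg arr s e :=
    seg_append arr (by omega) (by omega)
  have hlen1 : (seg arr s (s + l)).length = l := by
    rw [length_seg]
    omega
  have hes : EdgeSplit T (str u) lab (seg arr s (s + l)) (seg arr (s + l) e) := by
    refine ⟨hlab ▸ hedge, by omega, ?_, by omega, fun h => ?_⟩
    · have := hD.firstSym_eq hg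
      rw [hlab, List.getElem?_append_right le_rfl, Nat.sub_self] at this
      rw [this, hf, getElem?_seg, if_pos (by omega), Nat.add_zero]
    · rw [← List.length_pos_iff, length_seg] at h
      omega
  have hmem := hes.mem_iff
  rw [hsplit, ← hlab] at hmem
  rcases exists_edge_run hD P hg st n hlt hf hlab hl with
    ⟨t₁, ht₁, hm, hrun⟩ | ⟨t₁, ht₁, hm, hrun⟩ |
    ⟨hl2, hgu, hgv, w, r, arr₁, hr, hft, harr₁, hseg₁, hiff, hrun⟩
  · -- The pattern disagrees with the label.
    refine ⟨_, 0, none, arr, Outcome.none hD hp (fun h => hm (hmem.1 h).1) ?_ (Nat.zero_le _),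
      fun _ _ => rfl, iterate_step_add D P hpre hrun⟩
    rw [length_seg]
    nlinarith [show l ≤ e - s by omega, show 1 ≤ e - s by omega]
  · -- The pattern agrees with the label without a fast link.
    obtain ⟨t₂, h₂, r₂, arr₂, o₂, harr₂, hrun₂⟩ := ihL (e - (s + l)) (by omega) _ (s + l) e
      g.target arr st n (by omega) rfl rfl
    refine ⟨_, h₂, r₂, arr₂, ?_, fun i hi => harr₂ i (by omega),
      iterate_step_add D P (iterate_step_add D P hpre hrun) hrun₂⟩
    rw [← hsplit]
    exact o₂.of_edge hD hlab hes hm (by omega)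
  · -- A fast link is followed.
    obtain ⟨t₁, h₁, r₁, arr₂, o₁, harr₂, hrun₁⟩ : ∃ t h r arr',
        Outcome T str K w (seg arr₁ s (s + l)) t h r ∧
        (∀ i, i < s ∨ s + l ≤ i → arr' i = arr₁ i) ∧
        (step D P)^[t] ⟨Ctl.call s (s + l) w, arr₁, (s + l, e, g.target) :: st, n + 1⟩ =
          ⟨Ctl.ret r, arr', (s + l, e, g.target) :: st, n + 1 + h⟩ := by
      have := hft.length_lt
      rcases Nat.lt_or_ge l L with hlL | hlL
      · exact ihL l hlL _ s (s + l) w arr₁ _ _ (by omega) (by omega) rfl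
      · exact ihd _ (hd ▸ this) s (s + l) w arr₁ _ _ (by omega) (by omega) rfl
    have hpre₁ := iterate_step_add D P
      (iterate_step_add D P hpre (show (step D P)^[1] _ = _ from hrun)) hrun₁
    rw [hseg₁] at o₁
    have hm₁ : r₁.isSome ↔ seg arr s (s + l) <+: lab := by
      rw [o₁.isSome_iff, hft.unbranched.append_mem_iff (mem_prevSub_of_mem_nodes hft.node_append)
        (by simp only [getElem?_relabel, hes.first]) (by simpa using hes.length_le), hiff]
    rcases r₁ with _ | x
    · have hret : (step D P)^[1]
          ⟨Ctl.ret none, arr₂, (s + l, e, g.target) :: st, n + 1 + h₁⟩ =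
          ⟨Ctl.ret none, arr₂, st, n + (h₁ + 1)⟩ := by
        simp [step]
        omega
      have hm : ¬ seg arr s (s + l) <+: lab := by simp [← hm₁]
      refine ⟨_, h₁ + 1, none, arr₂, Outcome.none hD hp (fun h => hm (hmem.1 h).1) ?_ ?_,
        fun i hi => ?_, iterate_step_add D P hpre₁ hret⟩
      · have := o₁.time_le
        rw [length_relabel, hlen1] at this
        rw [length_seg]
        nlinarith [show l ≤ e - s by omega]
      · have h1 := o₁.hops_le
        have h2 := weight_relabel_le r (seg arr s (s + l))
        have h3 := hft.length_lt
        rw [length_relabel, hlen1] at h1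
        rw [← hsplit, weight_append, List.length_append, hlen1]
        omega
      · rw [harr₂ i (by omega), harr₁ i (by omega)]
    · have hret : (step D P)^[1]
          ⟨Ctl.ret (some x), arr₂, (s + l, e, g.target) :: st, n + 1 + h₁⟩ =
          ⟨Ctl.call (s + l) e g.target, arr₂, st, n + 1 + h₁⟩ := rfl
      have hm : seg arr s (s + l) <+: lab := hm₁.1 rfl
      obtain ⟨t₂, h₂, r₂, arr₃, o₂, harr₃, hrun₂⟩ := ihL (e - (s + l)) (by omega) _ (s + l) e
        g.target arr₂ st (n + 1 + h₁) (by omega) rfl rfl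
      have hseg₂ : seg arr₂ (s + l) e = seg arr (s + l) e := seg_congr fun i h1 _ => by
        rw [harr₂ i (by omega), harr₁ i (by omega)]
      rw [hseg₂] at o₂
      have hfin := iterate_step_add D P (iterate_step_add D P hpre₁ hret) hrun₂
      rw [show n + 1 + h₁ + h₂ = n + (h₁ + h₂ + 1) by omega] at hfin
      refine ⟨_, h₁ + h₂ + 1, r₂, arr₃, ?_, fun i hi => ?_, hfin⟩
      · rw [← hsplit]
        exact o₁.of_fastLink hD hlab hes (by omega) hgu hgv hr hft hm o₂ (by omega)
      · rw [harr₃ i (by omega), harr₂ i (by omega), harr₁ i (by omega)]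

/-! ### Encoding the pattern -/

theorem lastOcc_succ {w : List (PSym S Q)} {i : ℕ} {c : PSym S Q} (hc : w[i]? = some c) (x : Q) :
    lastOcc w (i + 1) x = if c = Sum.inr x then some i else lastOcc w i x := by
  split_ifs with h
  · rw [lastOcc_eq_some_iff]
    exact ⟨by omega, by rw [hc, h], fun j _ _ => by omega⟩
  · unfold lastOcc
    rw [List.range_succ, List.filter_append]
    simp [hc, h]

theorem exists_enc (D : Data S ν) (P : List (PSym S Q)) (i : ℕ) (hi : i ≤ P.length) :
    ∃ arr, (∀ j < i, (prevEnc P)[j]? = some (arr j)) ∧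
      (step D P)^[i] initial = ⟨Ctl.enc i (lastOcc P i), arr, [], 0⟩ := by
  induction i with
  | zero => exact ⟨fun _ => Sum.inr 0, by simp, rfl⟩
  | succ i ih =>
    obtain ⟨arr, harr, hrun⟩ := ih (by omega)
    have hget := List.getElem?_eq_getElem (show i < P.length by omega)
    refine ⟨Function.update arr i (encSym P i P[i]), fun j hj => ?_, ?_⟩
    · rcases Nat.lt_succ_iff_lt_or_eq.1 hj with hj | rfl
      · rw [Function.update_of_ne hj.ne, harr j hj]
      · rw [Function.update_self, getElem?_prevEnc, hget]
        rfl
    · rw [Function.iterate_succ_apply', hrun]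
      rcases hc : P[i] with a | x
      · have : lastOcc P (i + 1) = lastOcc P i := by
          funext y
          rw [lastOcc_succ hget, hc, if_neg (by simp)]
        rw [hc] at hget
        simp [step, hget, this, encSym]
      · have : lastOcc P (i + 1) = Function.update (lastOcc P i) x (some i) := by
          funext y
          rw [lastOcc_succ hget, hc, Function.update_apply]
          simp only [Sum.inr.injEq, eq_comm]
        rw [hc] at hget
        simp only [step, hget, this, encSym, prevDist_eq_match]

theorem exists_initial_call (D : Data S ν) (P : List (PSym S Q)) :
    ∃ arr, seg arr 0 P.length = prevEnc P ∧
      (step D P)^[P.length + 1] initial = ⟨Ctl.call 0 P.length D.root, arr, [], 0⟩ := by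
  obtain ⟨arr, harr, hrun⟩ := exists_enc D P P.length le_rfl
  refine ⟨arr, ?_, ?_⟩
  · apply List.ext_getElem?
    intro j
    rw [getElem?_seg]
    split_ifs with h
    · rw [harr j (by omega), Nat.zero_add]
    · exact (List.getElem?_eq_none (by rw [length_prevEnc]; omega)).symm
  · rw [Function.iterate_succ_apply', hrun]
    simp [step]

end Run

end PLST

theorem mainTheorem2 {S Q : Type*} [Fintype S] [Fintype Q] [DecidableEq S] [DecidableEq Q] :
    ∃ C : ℕ, ∀ (ν : Type*) (T₀ : List (PLST.PSym S Q)) (d : S),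
      (Sum.inl d : PLST.PSym S Q) ∉ T₀ →
      ∀ (D : PLST.Data S ν) (str : ν → List (PLST.PvSym S)),
        PLST.Represents (T₀ ++ [Sum.inl d]) D str →
        ∀ P : List (PLST.PSym S Q),
          (∃ (t : ℕ) (r : Option ν),
            t ≤ C * (P.length + 1) ∧
            ((PLST.step D P)^[t] PLST.initial).ctl = PLST.Ctl.done r ∧
            (r.isSome ↔ ∃ w, w <:+: T₀ ++ [Sum.inl d] ∧ PLST.PMatch w P) ∧
            ((PLST.step D P)^[t] PLST.initial).hops ≤ 3 * P.length) ∧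
          ∀ (u v : ν) (p : List (PLST.PvSym S)), str v = str u ++ p →
            ∃ t : ℕ,
              ((PLST.step D P)^[t] (PLST.callConfig p u)).ctl = PLST.Ctl.done (some v) ∧
              ((PLST.step D P)^[t] (PLST.callConfig p u)).hops ≤ 2 * p.length := by
  open PLST in
  -- Encoding takes `m + 1` steps, the call at the root at most `(K + 5) * 3m + (K + 6) * m + 1`
  -- steps for the bound `K` on the branching degree, and the last return takes one step.
  refine ⟨4 * (Fintype.card S + Fintype.card Q) + 22, fun ν T₀ d _ D str hD P => ⟨?_, ?_⟩⟩
  · obtain ⟨arr, harr, hcall⟩ := exists_initial_call D P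
    obtain ⟨t, h, r, arr', o, -, hrun⟩ := exists_outcome hD P hD.length_children_le _ _ 0 P.length
      D.root arr [] 0 (Nat.zero_le _) rfl rfl
    have hdone : (step D P)^[1] ⟨Ctl.ret r, arr', [], 0 + h⟩ = ⟨Ctl.done r, arr', [], 0 + h⟩ := rfl
    have hfin := iterate_step_add D P (iterate_step_add D P hcall hrun) hdone
    rw [harr] at o
    have hh : h ≤ 3 * P.length := by
      have h1 := o.hops_le
      have h2 := weight_le_length (prevEnc P)
      rw [hD.str_root, List.length_nil] at h1
      rw [length_prevEnc] at h1 h2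
      omega
    refine ⟨_, r, ?_, by rw [hfin], ?_, by rw [hfin]; simpa using hh⟩
    · have := o.time_le
      rw [length_prevEnc] at this
      nlinarith
    · rw [o.isSome_iff, hD.str_root, List.nil_append]
      exact exists_congr fun w => and_congr_right fun _ => pMatch_iff_prevEnc_eq.symm
  · intro u v p hv
    obtain ⟨t, h, r, arr', o, -, hrun⟩ := exists_outcome hD P hD.length_children_le _ _ 0 p.length
      u (fun i => p.getD i (Sum.inr 0)) [] 0 (Nat.zero_le _) rfl rfl
    rw [seg_getD] at o
    obtain rfl := o.eq_some v hv
    have hdone : (step D P)^[1] ⟨Ctl.ret (some v), arr', [], 0 + h⟩ =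
      ⟨Ctl.done (some v), arr', [], 0 + h⟩ := rfl
    have hfin := iterate_step_add D P hrun hdone
    have hfin' : (step D P)^[t + 1] (callConfig p u) = _ := hfin
    refine ⟨t + 1, by rw [hfin'], ?_⟩
    rw [hfin']
    simp only [Nat.zero_add]
    rcases eq_or_ne p [] with hp | hp
    · simp [o.hops_nil hp]
    · have h1 := o.hops_node hp (hv ▸ hD.mem_nodes v)
      have h2 := weight_le_length p
      omega
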